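/- Let $d\ge 1$ and let $X_t=(\xi_t,Y_t)$ be the Markov chain on the half-strip $\{0,1,2,\dots\}\times\{1,\dots,d\}$, with layers $L_n=\{n\}\times\{1,\dots,d\}$, whose transition matrix is block tridiagonal: from $(n,i)$ it moves to $(n+1,j)$, $(n,j)$, $(n-1,j)$ with probabilities $P_n(i,j)$, $R_n(i,j)$, $Q_n(i,j)$ respectively, where $P_n,Q_n,R_n$ are nonnegative $d\times d$ matrices, $(P_n+Q_n+R_n)\mathbf 1=\mathbf 1$, and $Q_0=R_0=0$ (so $P_0$ is stochastic). Assume: (C1) $\|R_n+P_n\|<1$ and $\|R_n+Q_n\|<1$ for all $n\ge1$, where $\|\cdot\|$ is the maximal row sum; (C2) $\sum_iP_n(i,j)>0$ for all $n\ge 0$ and all $j$, and $\sum_iQ_n(i,j)>0$ for all $n\ge1$ and all $j$; (C3) all states of layer $0$ belong to one communication class. For a probability vector $\mu$ on $\{1,\dots,d\}$ let $E_\mu(T_n^+)\in[1,\infty]$ be the mean of $T_n^+=\inf\{t\ge1: X_t\in L_n\}$ for the walk started from layer $n$ with distribution $\mu$ (the mean is $\infty$ if $P_\mu(T_n^+=\infty)>0$).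 Layer $n$ is called positive recurrent if $E_\mu(T_n^+)<\infty$ for every $\mu$, and the walk is called positive recurrent if all layers are. Fix a stochastic matrix $\rho$. Put $\zeta^-_{a,a}=\rho$ and $\zeta^-_{n,a}=(I-P_n\zeta^-_{n+1,a}-R_n)^{-1}Q_n$ for $1\le n<a$. When the limits $\zeta_n^-=\lim_{a\to\infty}\zeta^-_{n,a}$ exist for all $n\ge1$, put $A_n^-=(I-P_n\zeta^-_{n+1}-R_n)^{-1}P_n$, $\mathbf u_n^-=(I-P_n\zeta^-_{n+1}-R_n)^{-1}\mathbf 1$ for $n\ge 1$, and $$\varrho_1^+=\mathbf 1'P_0\Big(\sum_{k\ge1}A_1^-A_2^-\cdots A_{k-1}^-\mathbf u_k^-\Big)+d\in[0,\infty].$$ Theorem. For every stochastic $\rho$: (1) The walk is positive recurrent if and only if the limits $\zeta_n^-$ $(n\ge1)$ exist and $\varrho_1^+<\infty$. Positive recurrence of layer $0$ alone is also equivalent to this. (2) Whenever the limits $\zeta^-_n$ $(n\ge 1)$ exist, for every probability vector $\mu$ on $\{1,\dots,d\}$, $$E_\mu(T_0^+)=\mu P_0\Big(\sum_{k\ge1}A_1^-A_2^-\cdots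 A_{k-1}^-\mathbf u_k^-\Big)+\mu\mathbf 1 ,$$ as an equality in $[0,\infty]$ (with $0\cdot\infty=0$). -/

import Mathlib

open MeasureTheory ProbabilityTheory Filter Topology Matrix
open scoped ENNReal

noncomputable section

/-- The data of a state-dependent reflecting random walk on the half-strip `ℕ × {1, …, d}`:
nonnegative `d × d` blocks `P n` (one layer up), `Q n` (one layer down), `R n` (same layer), with
`(P n + Q n + R n) 𝟏 = 𝟏`. From layer `0` the walk can only move up: `Q 0 = R 0 = 0`, so `P 0` is
a stochastic matrix. -/
structure HalfStripWalk (d : ℕ) where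
  P : ℕ → Matrix (Fin d) (Fin d) ℝ
  Q : ℕ → Matrix (Fin d) (Fin d) ℝ
  R : ℕ → Matrix (Fin d) (Fin d) ℝ
  P_nonneg : ∀ n i j, 0 ≤ P n i j
  Q_nonneg : ∀ n i j, 0 ≤ Q n i j
  R_nonneg : ∀ n i j, 0 ≤ R n i j
  row_sum : ∀ n, (P n + Q n + R n) *ᵥ 1 = 1
  Q_zero : Q 0 = 0
  R_zero : R 0 = 0

namespace HalfStripWalk

variable {d : ℕ}

/-- The block tridiagonal transition matrix on `ℕ × {1, …, d}`. -/
def trans (W : HalfStripWalk d) : Matrix (ℕ × Fin d) (ℕ × Fin d) ℝ := fun x y =>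
  if y.1 = x.1 + 1 then W.P x.1 x.2 y.2
  else if y.1 = x.1 then W.R x.1 x.2 y.2
  else if y.1 + 1 = x.1 then W.Q x.1 x.2 y.2
  else 0

theorem trans_nonneg (W : HalfStripWalk d) (x y : ℕ × Fin d) : 0 ≤ W.trans x y := by
  unfold trans
  split_ifs
  exacts [W.P_nonneg _ _ _, W.R_nonneg _ _ _, W.Q_nonneg _ _ _, le_rfl]

theorem tsum_trans (W : HalfStripWalk d) (x : ℕ × Fin d) :
    ∑' y, ENNReal.ofReal (W.trans x y) = 1 := by
  obtain ⟨n, i⟩ := x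
  have hrow : ∑ j, W.P n i j + ∑ j, W.Q n i j + ∑ j, W.R n i j = 1 := by
    have h := congrFun (W.row_sum n) i
    simpa [Matrix.mulVec, dotProduct, Finset.sum_add_distrib] using h
  rw [ENNReal.tsum_prod']
  simp only [tsum_fintype]
  rw [tsum_eq_sum (s := Finset.range (n + 2))]
  · simp only [← ENNReal.ofReal_sum_of_nonneg (fun j _ => W.trans_nonneg (n, i) (_, j))]
    rw [← ENNReal.ofReal_sum_of_nonneg
      (fun m _ => Finset.sum_nonneg fun j _ => W.trans_nonneg (n, i) (m, j))]
    rw [← ENNReal.ofReal_one]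
    congr 1
    cases n with
    | zero =>
      simp [W.Q_zero, W.R_zero] at hrow
      simp [trans, hrow, W.R_zero]
    | succ k =>
      rw [Finset.sum_range_succ, Finset.sum_range_succ, Finset.sum_range_succ,
        Finset.sum_eq_zero]
      · have hk : ¬ k = k + 1 + 1 := by omega
        simp only [trans]
        simp [hk]
        linarith
      · intro m hm
        have hm' : m < k := Finset.mem_range.1 hm
        refine Finset.sum_eq_zero fun j _ => ?_
        simp only [trans]
        rw [if_neg (by omega), if_neg (by omega), if_neg (by omega)]
  · intro m hm
    have hm' : ¬ m < n + 2 := fun h => hm (Finset.mem_range.2 h)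
    refine Finset.sum_eq_zero fun j _ => ?_
    simp only [trans]
    rw [if_neg (by omega), if_neg (by omega), if_neg (by omega)]
    simp

/-- The one-step transition kernel. -/
def stepKernel (W : HalfStripWalk d) : Kernel (ℕ × Fin d) (ℕ × Fin d) where
  toFun x := Measure.sum fun y => ENNReal.ofReal (W.trans x y) • Measure.dirac y
  measurable' := Measurable.of_discrete

instance (W : HalfStripWalk d) : IsMarkovKernel W.stepKernel where
  isProbabilityMeasure x := ⟨by
    change (Measure.sum fun y => ENNReal.ofReal (W.trans x y) • Measure.dirac y) Set.univ = 1
    rw [Measure.sum_apply _ MeasurableSet.univ]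
    simpa using W.tsum_trans x⟩

/-- The kernel giving the next position from the whole past up to time `n`: only the present
position matters. -/
def historyKernel (W : HalfStripWalk d) (n : ℕ) :
    Kernel (Finset.Iic n → ℕ × Fin d) (ℕ × Fin d) :=
  W.stepKernel.comap (fun x => x ⟨n, Finset.mem_Iic.2 le_rfl⟩) (measurable_pi_apply _)

instance (W : HalfStripWalk d) (n : ℕ) : IsMarkovKernel (W.historyKernel n) := by
  unfold historyKernel
  infer_instance

/-- The law of the whole trajectory `(X 0, X 1, …)` of the walk when `X 0` is in layer `n` and
has distribution `μ` there. -/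
def law (W : HalfStripWalk d) (n : ℕ) (μ : PMF (Fin d)) : Measure (ℕ → ℕ × Fin d) :=
  Kernel.trajMeasure (X := fun _ => ℕ × Fin d) (μ.map fun i => (n, i)).toMeasure W.historyKernel

/-- The layer `n`. -/
def layer (d n : ℕ) : Set (ℕ × Fin d) := {x | x.1 = n}

/-- `T⁺ = inf {t ≥ 1 : X t ∈ layer n}`, equal to `⊤` if there is no such time. -/
def returnTime (n : ℕ) (X : ℕ → ℕ × Fin d) : ℕ∞ :=
  hittingAfter (fun t (ω : ℕ → ℕ × Fin d) => ω t) (layer d n) 1 X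

/-- The mean return time to layer `n` of the walk started from layer `n` with distribution `μ`;
it is infinite if the walk fails to return with positive probability. -/
def meanReturnTime (W : HalfStripWalk d) (n : ℕ) (μ : PMF (Fin d)) : ℝ≥0∞ :=
  ∫⁻ X, (returnTime n X : ℝ≥0∞) ∂(W.law n μ)

/-- Layer `n` is positive recurrent: the mean return time is finite for every initial distribution
on the layer. -/
def LayerPositiveRecurrent (W : HalfStripWalk d) (n : ℕ) : Prop :=
  ∀ μ : PMF (Fin d), W.meanReturnTime n μ < ∞

/-- The walk is positive recurrent: every layer is. -/
def PositiveRecurrent (W : HalfStripWalk d) : Prop :=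
  ∀ n, W.LayerPositiveRecurrent n

section

attribute [local instance] Matrix.linftyOpNormedAddCommGroup

/-- The standing conditions. The norm in `norm_RP`, `norm_RQ` is the operator norm for the sup norm
on vectors, that is, the maximal row sum. -/
structure ConditionC (W : HalfStripWalk d) : Prop where
  norm_RP : ∀ n, 1 ≤ n → ‖W.R n + W.P n‖ < 1
  norm_RQ : ∀ n, 1 ≤ n → ‖W.R n + W.Q n‖ < 1
  col_P : ∀ n j, 0 < ∑ i, W.P n i j
  col_Q : ∀ n, 1 ≤ n → ∀ j, 0 < ∑ i, W.Q n i j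
  /-- All states of layer `0` lie in one communication class. -/
  layer_zero : ∀ i j, Relation.ReflTransGen (fun x y => 0 < W.trans x y) (0, i) (0, j)

end

/-- `W.exitFrom ρ k n` is the matrix `ζ⁻_{n, n + k}`, obtained from `ζ⁻_{a, a} = ρ` (`a = n + k`)
by the recursion `ζ⁻_{n, a} = (I - P n ζ⁻_{n+1, a} - R n)⁻¹ Q n`. -/
def exitFrom (W : HalfStripWalk d) (ρ : Matrix (Fin d) (Fin d) ℝ) :
    ℕ → ℕ → Matrix (Fin d) (Fin d) ℝ
  | 0, _ => ρ
  | k + 1, n => (1 - W.P n * W.exitFrom ρ k (n + 1) - W.R n)⁻¹ * W.Q n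

/-- The matrix `ζ⁻_{n, a}` for `n ≤ a`. -/
def exitMatrix (W : HalfStripWalk d) (ρ : Matrix (Fin d) (Fin d) ℝ) (n a : ℕ) :
    Matrix (Fin d) (Fin d) ℝ :=
  W.exitFrom ρ (a - n) n

/-- `ζ⁻_n = lim_{a → ∞} ζ⁻_{n, a}` for all `n ≥ 1` (the limits exist and are the matrices `ζ n`).
The value `ζ 0` plays no role. -/
def IsExitLimit (W : HalfStripWalk d) (ρ : Matrix (Fin d) (Fin d) ℝ)
    (ζ : ℕ → Matrix (Fin d) (Fin d) ℝ) : Prop :=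
  ∀ n, 1 ≤ n → Tendsto (fun a => W.exitMatrix ρ n a) atTop (𝓝 (ζ n))

/-- `A⁻_n = (I - P n ζ⁻_{n+1} - R n)⁻¹ P n`. -/
def Aminus (W : HalfStripWalk d) (ζ : ℕ → Matrix (Fin d) (Fin d) ℝ) (n : ℕ) :
    Matrix (Fin d) (Fin d) ℝ :=
  (1 - W.P n * ζ (n + 1) - W.R n)⁻¹ * W.P n

/-- `u⁻_n = (I - P n ζ⁻_{n+1} - R n)⁻¹ 𝟏`. -/
def uminus (W : HalfStripWalk d) (ζ : ℕ → Matrix (Fin d) (Fin d) ℝ) (n : ℕ) : Fin d → ℝ :=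
  (1 - W.P n * ζ (n + 1) - W.R n)⁻¹ *ᵥ 1

/-- The product `A⁻_1 A⁻_2 ⋯ A⁻_m` (the identity for `m = 0`). -/
def prodAminus (W : HalfStripWalk d) (ζ : ℕ → Matrix (Fin d) (Fin d) ℝ) :
    ℕ → Matrix (Fin d) (Fin d) ℝ
  | 0 => 1
  | m + 1 => W.prodAminus ζ m * W.Aminus ζ (m + 1)

/-- The vector `∑_{k ≥ 1} A⁻_1 ⋯ A⁻_{k-1} u⁻_k` with entries in `[0, ∞]` (here `k = m + 1`). -/
def seriesVec (W : HalfStripWalk d) (ζ : ℕ → Matrix (Fin d) (Fin d) ℝ) (j : Fin d) : ℝ≥0∞ :=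
  ∑' m : ℕ, ENNReal.ofReal ((W.prodAminus ζ m *ᵥ W.uminus ζ (m + 1)) j)

/-- `ϱ₁⁺ = 𝟏' P₀ (∑_{k ≥ 1} A⁻_1 ⋯ A⁻_{k-1} u⁻_k) + d`, in `[0, ∞]`. -/
def varrhoOne (W : HalfStripWalk d) (ζ : ℕ → Matrix (Fin d) (Fin d) ℝ) : ℝ≥0∞ :=
  ∑ i, ∑ j, ENNReal.ofReal (W.P 0 i j) * W.seriesVec ζ j + d

/-- `μ P₀ (∑_{k ≥ 1} A⁻_1 ⋯ A⁻_{k-1} u⁻_k) + μ 𝟏`, in `[0, ∞]`. -/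
def varrho (W : HalfStripWalk d) (ζ : ℕ → Matrix (Fin d) (Fin d) ℝ) (μ : PMF (Fin d)) : ℝ≥0∞ :=
  ∑ i, ∑ j, μ i * ENNReal.ofReal (W.P 0 i j) * W.seriesVec ζ j + ∑ i, μ i

end HalfStripWalk

end

noncomputable section

namespace HalfStripWalk

variable {d : ℕ}

/-! The mean return time to layer `n` is the expected lifetime `killedTime` of the walk killed when
it enters that layer at a positive time. A lifetime solves `v = 1 + K v`, with `K` the killed step,
and lies below every supersolution (`killedTime_eq`, `killedTime_le`). Explicit supersolutions show
that climbing to a higher layer takes finite mean time, and that layer `0` alone decides positive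
recurrence (`positiveRecurrent_iff_layer_zero`).

Starting from layer `0`, the lifetime reduces to that from layer `1`. Killing also at layer `a`
turns the latter into a finite block tridiagonal system, and eliminating layers downward from `a`
produces the recursion for `ζ⁻_{n,a}` with terminal matrix `0`. These matrices increase with `a` to
`minExit`, and monotone limits give the series formula with `ζ = minExit` (`killedTime_layer_one`).

It remains to compare a terminal matrix `ρ` with `0`. Any limit `ζ` dominates `minExit`, so its
series is at least as large. If the `minExit` series is finite at a state, its terms tend to `0`.
They dominate the escape probability, a constant, which therefore vanishes; then `ζ` and `minExit`
agree wherever the series from that state looks, and the two series coincide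
(`IsExitLimit.seriesVec_eq`). If layer `0` is positive recurrent, every `minExit n` is stochastic,
which leaves no room between the exit matrices for `0` and for `ρ`, so the limits exist
(`isExitLimit_of_layerPositiveRecurrent`). -/

/-- One step of the walk acting on functions, killed outside the layers in `S`. -/
def killedOp (W : HalfStripWalk d) (S : Set ℕ) (φ : ℕ × Fin d → ℝ≥0∞) (x : ℕ × Fin d) : ℝ≥0∞ :=
  ∑' y, ENNReal.ofReal (W.trans x y) * (Prod.fst ⁻¹' S).indicator φ y

/-- The expected lifetime of the walk killed when it jumps outside the layers in `S`. -/
def killedTime (W : HalfStripWalk d) (S : Set ℕ) (x : ℕ × Fin d) : ℝ≥0∞ :=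
  ∑' t : ℕ, (W.killedOp S)^[t] 1 x

/-! ### From the trajectory measure to the killed operator. -/

theorem lintegral_stepKernel (W : HalfStripWalk d) (x : ℕ × Fin d) (φ : ℕ × Fin d → ℝ≥0∞) :
    ∫⁻ y, φ y ∂(W.stepKernel x) = ∑' y, ENNReal.ofReal (W.trans x y) * φ y := by
  change ∫⁻ y, φ y ∂(Measure.sum fun y => ENNReal.ofReal (W.trans x y) • Measure.dirac y) = _
  rw [lintegral_sum_measure]
  simp [lintegral_smul_measure]

theorem lintegral_law_zero (W : HalfStripWalk d) (n : ℕ) (μ : PMF (Fin d))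
    (φ : ℕ × Fin d → ℝ≥0∞) : ∫⁻ X, φ (X 0) ∂(W.law n μ) = ∑ i, μ i * φ (n, i) := by
  have hm : (W.law n μ).map (Preorder.frestrictLe 0) =
      ((μ.map fun i => (n, i)).toMeasure).map
        (MeasurableEquiv.piUnique (fun _ : Finset.Iic (0 : ℕ) => ℕ × Fin d)).symm := by
    rw [law, Kernel.trajMeasure, Measure.map_comp _ _ (by fun_prop), Kernel.traj_map_frestrictLe,
      Kernel.partialTraj_self, Measure.id_comp]
  have h1 : ∫⁻ X, φ (X 0) ∂(W.law n μ) =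
      ∫⁻ p, φ (p ⟨0, Finset.mem_Iic.2 le_rfl⟩) ∂((W.law n μ).map (Preorder.frestrictLe 0)) := by
    rw [lintegral_map (Measurable.of_discrete) (by fun_prop)]
    rfl
  rw [h1, hm, lintegral_map (Measurable.of_discrete) (by fun_prop)]
  change ∫⁻ a, φ a ∂((μ.map fun i => (n, i)).toMeasure) = _
  rw [← PMF.toMeasure_map _ _ Measurable.of_discrete,
    lintegral_map Measurable.of_discrete Measurable.of_discrete,
    lintegral_fintype]
  refine Finset.sum_congr rfl fun i _ => ?_
  rw [PMF.toMeasure_apply_singleton _ _ (MeasurableSet.singleton i), mul_comm]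

/-- The trajectories that avoid the layer `n` at the times `1, …, t`. -/
def avoid (d n t : ℕ) : Set (ℕ → ℕ × Fin d) := {X | ∀ s, 1 ≤ s → s ≤ t → (X s).1 ≠ n}

theorem measurableSet_avoid (d n t : ℕ) : MeasurableSet (avoid d n t) := by
  simp only [avoid, Set.ofPred_forall]
  refine MeasurableSet.iInter fun s => MeasurableSet.iInter fun _ => MeasurableSet.iInter fun _ => ?_
  have : Measurable fun X : ℕ → ℕ × Fin d => (X s).1 := by fun_prop
  exact this (MeasurableSet.of_discrete (s := {m | m ≠ n}))

/-- Markov property, peeling off the last step. Time `0` is not tested, so the walk may start in the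
forbidden layer. -/
theorem lintegral_avoid (W : HalfStripWalk d) (n : ℕ) (μ : PMF (Fin d)) (t : ℕ)
    (φ : ℕ × Fin d → ℝ≥0∞) :
    ∫⁻ X, (avoid d n t).indicator (fun X => φ (X t)) X ∂(W.law n μ) =
      ∑ i, μ i * (W.killedOp {n}ᶜ)^[t] φ (n, i) := by
  induction t generalizing φ with
  | zero =>
    have : avoid d n 0 = Set.univ := by
      ext X
      simp only [avoid, Set.mem_ofPred_eq, Set.mem_univ, iff_true]
      omega
    simpa [this] using W.lintegral_law_zero n μ φ
  | succ t ih =>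
    let A : Set (Finset.Iic t → ℕ × Fin d) := {p | ∀ s : Finset.Iic t, 1 ≤ s.1 → (p s).1 ≠ n}
    let ψ : ℕ × Fin d → ℝ≥0∞ := (Prod.fst ⁻¹' ({n}ᶜ : Set ℕ)).indicator φ
    let g : (Finset.Iic t → ℕ × Fin d) × (ℕ × Fin d) → ℝ≥0∞ := fun q => A.indicator 1 q.1 * ψ q.2
    have hA : ∀ X : ℕ → ℕ × Fin d, Preorder.frestrictLe t X ∈ A ↔ X ∈ avoid d n t := by
      intro X
      simp only [A, avoid, Set.mem_ofPred_eq, Preorder.frestrictLe_apply]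
      exact ⟨fun h s h1 h2 => h ⟨s, Finset.mem_Iic.2 h2⟩ h1,
        fun h s h1 => h s.1 h1 (Finset.mem_Iic.1 s.2)⟩
    have hg : ∀ X : ℕ → ℕ × Fin d, (avoid d n (t + 1)).indicator (fun X => φ (X (t + 1))) X =
        g (Preorder.frestrictLe t X, X (t + 1)) := by
      intro X
      have hsucc : X ∈ avoid d n (t + 1) ↔ X ∈ avoid d n t ∧ (X (t + 1)).1 ≠ n := by
        simp only [avoid, Set.mem_ofPred_eq]
        refine ⟨fun h => ⟨fun s h1 h2 => h s h1 (by omega), h _ (by omega) le_rfl⟩, ?_⟩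
        rintro ⟨h, h'⟩ s h1 h2
        rcases Nat.lt_or_ge t s with h3 | h3
        · obtain rfl : s = t + 1 := by omega
          exact h'
        · exact h s h1 h3
      simp only [g, ψ]
      by_cases h1 : X ∈ avoid d n t <;> by_cases h2 : (X (t + 1)).1 = n <;>
        simp [Set.indicator, hsucc, hA, h1, h2]
    have hmg : Measurable g := Measurable.of_discrete
    -- The joint law of the past up to `t` and the next position is the law of the past composed
    -- with the step kernel.
    have key := Kernel.map_frestrictLe_trajMeasure_compProd_eq_map_trajMeasure (X := fun _ => ℕ × Fin d)
      (μ₀ := (μ.map fun i => (n, i)).toMeasure) (κ := W.historyKernel) (a := t)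
    change (W.law n μ).map (Preorder.frestrictLe t) ⊗ₘ W.historyKernel t =
      (W.law n μ).map (fun x => (Preorder.frestrictLe t x, x (t + 1))) at key
    have hstep : ∀ p : Finset.Iic t → ℕ × Fin d, ∫⁻ y, g (p, y) ∂(W.historyKernel t p) =
        A.indicator 1 p * W.killedOp {n}ᶜ φ (p ⟨t, Finset.mem_Iic.2 le_rfl⟩) := by
      intro p
      simp only [g]
      rw [lintegral_const_mul _ Measurable.of_discrete]
      congr 1
      exact W.lintegral_stepKernel _ _
    have : IsProbabilityMeasure (W.law n μ) := by
      unfold law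
      have : IsProbabilityMeasure ((μ.map fun i => (n, i)).toMeasure) := inferInstance
      infer_instance
    rw [Function.iterate_succ_apply, ← ih, lintegral_congr hg,
      ← lintegral_map (f := g) hmg (by fun_prop), ← key, Measure.lintegral_compProd hmg,
      lintegral_congr hstep, lintegral_map Measurable.of_discrete (by fun_prop)]
    refine lintegral_congr fun X => ?_
    by_cases h1 : X ∈ avoid d n t <;> simp [Set.indicator, hA, h1]

/-- Tail-sum formula: `T` is the number of `t ≥ 0` with `t < T`, also when `T = ⊤`. -/
theorem coe_returnTime (n : ℕ) (X : ℕ → ℕ × Fin d) :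
    ((returnTime n X : ℕ∞) : ℝ≥0∞) = ∑' t : ℕ, (avoid d n t).indicator 1 X := by
  have hmem : ∀ t : ℕ, X ∈ avoid d n t ↔ (t : ℕ∞) < returnTime n X := by
    intro t
    rw [← not_le]
    have := hittingAfter_le_iff (u := fun t (ω : ℕ → ℕ × Fin d) => ω t) (s := layer d n) (n := 1)
      (i := t) (ω := X)
    unfold returnTime
    erw [this]
    simp only [avoid, layer, Set.mem_ofPred_eq, Set.mem_Icc]
    push Not
    exact ⟨fun h s hs => h s hs.1 hs.2, fun h s h1 h2 => h s ⟨h1, h2⟩⟩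
  have hterm : ∀ t : ℕ, (avoid d n t).indicator (1 : (ℕ → ℕ × Fin d) → ℝ≥0∞) X =
      if (t : ℕ∞) < returnTime n X then 1 else 0 := by
    intro t
    simp [Set.indicator, hmem]
  simp only [hterm]
  induction returnTime n X using ENat.recTopCoe with
  | top => simp
  | coe m =>
    rw [tsum_eq_sum (s := Finset.range m)]
    · simp [Finset.filter_true_of_mem]
    · intro t ht
      simpa using ht

theorem meanReturnTime_eq (W : HalfStripWalk d) (n : ℕ) (μ : PMF (Fin d)) :
    W.meanReturnTime n μ = ∑ i, μ i * W.killedTime {n}ᶜ (n, i) := by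
  unfold meanReturnTime
  simp only [coe_returnTime]
  rw [lintegral_tsum fun t => (measurable_one.indicator (measurableSet_avoid d n t)).aemeasurable]
  have := fun t => W.lintegral_avoid n μ t 1
  simp only [Pi.one_apply] at this
  simp only [killedTime, ← ENNReal.tsum_mul_left]
  rw [← Summable.tsum_finsetSum fun _ _ => ENNReal.summable]
  exact tsum_congr this

/-! ### Lifetimes of killed walks: minimality, monotonicity, truncation. -/

theorem trans_eq_zero_of_far (W : HalfStripWalk d) {x y : ℕ × Fin d}
    (h : x.1 + 1 < y.1 ∨ y.1 + 1 < x.1) : W.trans x y = 0 := by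
  unfold trans
  rw [if_neg (by omega), if_neg (by omega), if_neg (by omega)]

theorem killedOp_le_of_near (W : HalfStripWalk d) {S S' : Set ℕ} {φ φ' : ℕ × Fin d → ℝ≥0∞}
    {x : ℕ × Fin d} (h : ∀ y : ℕ × Fin d, y.1 ≤ x.1 + 1 → x.1 ≤ y.1 + 1 →
      (Prod.fst ⁻¹' S).indicator φ y ≤ (Prod.fst ⁻¹' S').indicator φ' y) :
    W.killedOp S φ x ≤ W.killedOp S' φ' x := by
  refine ENNReal.tsum_le_tsum fun y => ?_
  by_cases hy : x.1 + 1 < y.1 ∨ y.1 + 1 < x.1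
  · simp [W.trans_eq_zero_of_far hy]
  · push Not at hy
    gcongr
    exact h y hy.1 hy.2

theorem killedOp_mono (W : HalfStripWalk d) {S S' : Set ℕ} (hS : S ⊆ S')
    {φ φ' : ℕ × Fin d → ℝ≥0∞} (h : ∀ y : ℕ × Fin d, y.1 ∈ S → φ y ≤ φ' y) (x : ℕ × Fin d) :
    W.killedOp S φ x ≤ W.killedOp S' φ' x := by
  refine W.killedOp_le_of_near fun y _ _ => ?_
  by_cases hy : y.1 ∈ S
  · simpa [Set.indicator, hy, hS hy] using h y hy
  · simp [Set.indicator, hy]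

theorem killedOp_finsetSum (W : HalfStripWalk d) (S : Set ℕ) (s : Finset ℕ)
    (φ : ℕ → ℕ × Fin d → ℝ≥0∞) (x : ℕ × Fin d) :
    W.killedOp S (fun y => ∑ t ∈ s, φ t y) x = ∑ t ∈ s, W.killedOp S (φ t) x := by
  unfold killedOp
  rw [← Summable.tsum_finsetSum fun _ _ => ENNReal.summable]
  refine tsum_congr fun y => ?_
  rw [← Finset.mul_sum]
  by_cases hy : y.1 ∈ S <;> simp [Set.indicator, hy]

theorem killedTime_eq (W : HalfStripWalk d) (S : Set ℕ) (x : ℕ × Fin d) :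
    W.killedTime S x = 1 + W.killedOp S (W.killedTime S) x := by
  conv_lhs => unfold killedTime
  rw [tsum_eq_zero_add' ENNReal.summable]
  congr 1
  have hstep : ∀ t, (W.killedOp S)^[t + 1] 1 x =
      ∑' y, ENNReal.ofReal (W.trans x y) *
        (Prod.fst ⁻¹' S).indicator ((W.killedOp S)^[t] 1) y := fun t => by
    rw [Function.iterate_succ_apply']
    rfl
  simp only [hstep]
  rw [ENNReal.tsum_comm]
  refine tsum_congr fun y => ?_
  rw [ENNReal.tsum_mul_left]
  by_cases hy : y.1 ∈ S <;> simp [Set.indicator, hy, killedTime]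

/-- Each partial sum of the lifetime stays below a supersolution, by induction on the number of
steps. The value `∞` is allowed for `v`, so `v` may be set to `∞` wherever the walk cannot go before
being killed. -/
theorem killedTime_le (W : HalfStripWalk d) {S : Set ℕ} {v : ℕ × Fin d → ℝ≥0∞}
    (hv : ∀ x : ℕ × Fin d, x.1 ∈ S → 1 + W.killedOp S v x ≤ v x) {x : ℕ × Fin d} (hx : x.1 ∈ S) :
    W.killedTime S x ≤ v x := by
  refine ENNReal.tsum_le_of_sum_range_le fun T => ?_
  induction T generalizing x with
  | zero => simp
  | succ T ih =>
    rw [Finset.sum_range_succ', add_comm]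
    refine le_trans ?_ (hv x hx)
    gcongr
    · simp
    · simp only [Function.iterate_succ_apply']
      rw [← killedOp_finsetSum]
      exact W.killedOp_mono subset_rfl (fun y hy => ih hy) x

theorem iterate_killedOp_mono (W : HalfStripWalk d) {S S' : Set ℕ} (hS : S ⊆ S') (t : ℕ)
    (φ : ℕ × Fin d → ℝ≥0∞) (x : ℕ × Fin d) :
    (W.killedOp S)^[t] φ x ≤ (W.killedOp S')^[t] φ x := by
  induction t generalizing x with
  | zero => rfl
  | succ t ih =>
    rw [Function.iterate_succ_apply', Function.iterate_succ_apply']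
    exact W.killedOp_mono hS (fun y _ => ih y) x

theorem killedTime_mono (W : HalfStripWalk d) {S S' : Set ℕ} (hS : S ⊆ S') (x : ℕ × Fin d) :
    W.killedTime S x ≤ W.killedTime S' x :=
  ENNReal.tsum_le_tsum fun t => W.iterate_killedOp_mono hS t 1 x

/-- The layer rises by at most one per step, so a barrier at `a` is not felt before time `a - x.1`.
-/
theorem iterate_killedOp_le_inter_Iio (W : HalfStripWalk d) (S : Set ℕ) (φ : ℕ × Fin d → ℝ≥0∞)
    (a t : ℕ) (x : ℕ × Fin d) (h : x.1 + t < a) :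
    (W.killedOp S)^[t] φ x ≤ (W.killedOp (S ∩ Set.Iio a))^[t] φ x := by
  induction t generalizing x with
  | zero => rfl
  | succ t ih =>
    rw [Function.iterate_succ_apply', Function.iterate_succ_apply']
    refine W.killedOp_le_of_near fun y hy _ => ?_
    by_cases hyS : y.1 ∈ S
    · have hya : y.1 < a := by omega
      simpa [Set.indicator, hyS, hya] using ih y (by omega)
    · simp [Set.indicator, hyS]

theorem killedTime_le_of_forall_inter_Iio (W : HalfStripWalk d) {S : Set ℕ} {x : ℕ × Fin d}
    {c : ℝ≥0∞} (h : ∀ a, x.1 < a → W.killedTime (S ∩ Set.Iio a) x ≤ c) : W.killedTime S x ≤ c := by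
  refine ENNReal.tsum_le_of_sum_range_le fun T => ?_
  refine le_trans ?_ (h (x.1 + T + 1) (by omega))
  refine le_trans (Finset.sum_le_sum fun t ht => W.iterate_killedOp_le_inter_Iio S 1 (x.1 + T + 1) t x ?_)
    (ENNReal.sum_le_tsum _)
  have := Finset.mem_range.1 ht
  omega

theorem killedOp_eq_sum (W : HalfStripWalk d) (S : Set ℕ) (φ : ℕ × Fin d → ℝ≥0∞) (n : ℕ)
    (i : Fin d) : W.killedOp S φ (n, i) =
      ∑ j, (ENNReal.ofReal (W.P n i j) * (Prod.fst ⁻¹' S).indicator φ (n + 1, j) +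
        ENNReal.ofReal (W.R n i j) * (Prod.fst ⁻¹' S).indicator φ (n, j) +
        ENNReal.ofReal (W.Q n i j) * (Prod.fst ⁻¹' S).indicator φ (n - 1, j)) := by
  unfold killedOp
  rw [ENNReal.tsum_prod', ENNReal.tsum_comm, tsum_fintype]
  refine Finset.sum_congr rfl fun j _ => ?_
  cases n with
  | zero =>
    rw [tsum_eq_sum (s := {0, 1})]
    · rw [Finset.sum_pair (by omega)]
      simp [trans, W.Q_zero, add_comm]
    · intro m hm
      rw [W.trans_eq_zero_of_far]
      · simp
      · simp at hm ⊢
        omega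
  | succ k =>
    rw [tsum_eq_sum (s := {k + 2, k + 1, k})]
    · rw [Finset.sum_insert (by simp), Finset.sum_pair (by omega), ← add_assoc]
      have hk : ¬ k = k + 1 + 1 := by omega
      simp [trans, hk]
    · intro m hm
      rw [W.trans_eq_zero_of_far]
      · simp
      · simp at hm ⊢
        omega

/-! ### Climbing to a higher layer takes finite mean time. -/

theorem rowSum_add (W : HalfStripWalk d) (n : ℕ) (i : Fin d) :
    ∑ j, W.P n i j + ∑ j, W.Q n i j + ∑ j, W.R n i j = 1 := by
  have h := congrFun (W.row_sum n) i
  simpa [Matrix.mulVec, dotProduct, Finset.sum_add_distrib] using h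

section

attribute [local instance] Matrix.linftyOpNormedAddCommGroup

theorem rowSum_le_norm (M : Matrix (Fin d) (Fin d) ℝ) (i : Fin d) : ∑ j, M i j ≤ ‖M‖ := by
  rw [Matrix.linfty_opNorm_def]
  have h1 : ∑ j, M i j ≤ ((∑ j, ‖M i j‖₊ : NNReal) : ℝ) := by
    push_cast
    exact Finset.sum_le_sum fun j _ => Real.le_norm_self _
  exact h1.trans (NNReal.coe_le_coe.2
    (Finset.le_sup (f := fun i => ∑ j, ‖M i j‖₊) (Finset.mem_univ i)))

theorem ConditionC.rowSum_RP_lt {W : HalfStripWalk d} (hC : W.ConditionC) {n : ℕ} (hn : 1 ≤ n)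
    (i : Fin d) : ∑ j, W.R n i j + ∑ j, W.P n i j < 1 := by
  have := (rowSum_le_norm (W.R n + W.P n) i).trans_lt (hC.norm_RP n hn)
  simpa [Finset.sum_add_distrib] using this

theorem ConditionC.exists_le_rowSum_P {W : HalfStripWalk d} (hC : W.ConditionC) (n : ℕ) :
    ∃ p : ℝ, 0 < p ∧ ∀ i, p ≤ ∑ j, W.P n i j := by
  rcases Nat.eq_zero_or_pos n with rfl | hn
  · refine ⟨1, one_pos, fun i => ?_⟩
    have := W.rowSum_add 0 i
    simp [W.Q_zero, W.R_zero] at this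
    exact this.ge
  · refine ⟨1 - ‖W.R n + W.Q n‖, sub_pos.2 (hC.norm_RQ n hn), fun i => ?_⟩
    have := rowSum_le_norm (W.R n + W.Q n) i
    simp only [Matrix.add_apply, Finset.sum_add_distrib] at this
    linarith [W.rowSum_add n i]

end

/-- `h m` will bound the mean time from layer `m` to layer `m + 1`. With `p m` a positive lower
bound for the row sums of `P m`, it is enough to solve `p m * h m = 1 + h (m - 1)`, as `Q m` has row
sums at most `1`. At `m = 0` the truncated `m - 1` is harmless because `Q 0 = 0`. -/
theorem ConditionC.exists_climbing_bound {W : HalfStripWalk d} (hC : W.ConditionC) :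
    ∃ h : ℕ → ℝ, (∀ m, 0 ≤ h m) ∧
      ∀ m i, 1 + (∑ j, W.Q m i j) * h (m - 1) ≤ (∑ j, W.P m i j) * h m := by
  choose p hp hpP using hC.exists_le_rowSum_P
  let h : ℕ → ℝ := fun m => Nat.rec (1 / p 0) (fun m h => (1 + h) / p (m + 1)) m
  have h0 : ∀ m, 0 ≤ h m := by
    intro m
    induction m with
    | zero => exact (one_div_pos.2 (hp 0)).le
    | succ m ih => exact div_nonneg (by linarith) (hp _).le
  refine ⟨h, h0, fun m i => ?_⟩
  have h1 : p m * h m ≤ (∑ j, W.P m i j) * h m := mul_le_mul_of_nonneg_right (hpP m i) (h0 m)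
  refine le_trans ?_ h1
  cases m with
  | zero =>
    have : p 0 * h 0 = 1 := mul_one_div_cancel (hp 0).ne'
    simp [W.Q_zero, this]
  | succ m =>
    have h2 : p (m + 1) * h (m + 1) = 1 + h m := mul_div_cancel₀ _ (hp _).ne'
    have h3 : ∑ j, W.Q (m + 1) i j ≤ 1 := by
      have := W.rowSum_add (m + 1) i
      have h4 := Finset.sum_nonneg fun j (_ : j ∈ Finset.univ) => W.P_nonneg (m + 1) i j
      have h5 := Finset.sum_nonneg fun j (_ : j ∈ Finset.univ) => W.R_nonneg (m + 1) i j
      linarith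
    rw [h2, Nat.add_sub_cancel]
    nlinarith [mul_le_mul_of_nonneg_right h3 (h0 m)]

theorem ConditionC.killedTime_lt_top_of_lt {W : HalfStripWalk d} (hC : W.ConditionC) {m n : ℕ}
    (hm : m < n) (i : Fin d) : W.killedTime {n}ᶜ (m, i) < ∞ := by
  obtain ⟨h, h0, hh⟩ := hC.exists_climbing_bound
  let w : ℕ → ℝ := fun m => ∑ l ∈ Finset.Ico m n, h l
  have hw0 : ∀ m, 0 ≤ w m := fun m => Finset.sum_nonneg fun l _ => h0 l
  have hw : ∀ m, m < n → w m = h m + w (m + 1) := fun m hm => by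
    simp only [w]
    rw [Finset.sum_eq_sum_Ico_succ_bot hm]
  -- From below `n` the walk meets layer `n`, where it is killed, before any higher layer; hence the
  -- value `∞` never enters.
  let v : ℕ × Fin d → ℝ≥0∞ := fun x => if x.1 < n then ENNReal.ofReal (w x.1) else ∞
  have hv : W.killedTime {n}ᶜ (m, i) ≤ v (m, i) := by
    refine W.killedTime_le (fun x _ => ?_) (by simpa using hm.ne)
    obtain ⟨k, i⟩ := x
    by_cases hk : k < n
    · have hind : ∀ l ≤ n, ∀ j : Fin d,
          (Prod.fst ⁻¹' ({n}ᶜ : Set ℕ)).indicator v (l, j) ≤ ENNReal.ofReal (w l) := by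
        intro l hl j
        rcases hl.lt_or_eq with hl | rfl
        · simp [Set.indicator, v, hl, hl.ne]
        · simp [Set.indicator]
      have hk' : k + 1 ≤ n := hk
      rw [killedOp_eq_sum]
      calc 1 + _ ≤ 1 + ∑ j, (ENNReal.ofReal (W.P k i j) * ENNReal.ofReal (w (k + 1)) +
            ENNReal.ofReal (W.R k i j) * ENNReal.ofReal (w k) +
            ENNReal.ofReal (W.Q k i j) * ENNReal.ofReal (w (k - 1))) := by
            gcongr <;> exact hind _ (by omega) _
        _ = ENNReal.ofReal (1 + ((∑ j, W.P k i j) * w (k + 1) + (∑ j, W.R k i j) * w k +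
              (∑ j, W.Q k i j) * w (k - 1))) := by
            simp only [Finset.sum_mul, ← Finset.sum_add_distrib]
            have hnn : ∀ j, 0 ≤ W.P k i j * w (k + 1) + W.R k i j * w k + W.Q k i j * w (k - 1) :=
              fun j => add_nonneg (add_nonneg (mul_nonneg (W.P_nonneg _ _ _) (hw0 _))
                (mul_nonneg (W.R_nonneg _ _ _) (hw0 _))) (mul_nonneg (W.Q_nonneg _ _ _) (hw0 _))
            rw [ENNReal.ofReal_add zero_le_one (Finset.sum_nonneg fun j _ => hnn j),
              ENNReal.ofReal_one, ENNReal.ofReal_sum_of_nonneg fun j _ => hnn j]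
            congr 1
            refine Finset.sum_congr rfl fun j _ => ?_
            rw [ENNReal.ofReal_add (add_nonneg (mul_nonneg (W.P_nonneg _ _ _) (hw0 _))
                (mul_nonneg (W.R_nonneg _ _ _) (hw0 _))) (mul_nonneg (W.Q_nonneg _ _ _) (hw0 _)),
              ENNReal.ofReal_add (mul_nonneg (W.P_nonneg _ _ _) (hw0 _))
                (mul_nonneg (W.R_nonneg _ _ _) (hw0 _)), ENNReal.ofReal_mul (W.P_nonneg _ _ _),
              ENNReal.ofReal_mul (W.R_nonneg _ _ _), ENNReal.ofReal_mul (W.Q_nonneg _ _ _)]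
        _ ≤ v (k, i) := by
            simp only [v, if_pos hk]
            refine ENNReal.ofReal_le_ofReal ?_
            have e1 := hw k hk
            have e2 : (∑ j, W.Q k i j) * w (k - 1) =
                (∑ j, W.Q k i j) * h (k - 1) + (∑ j, W.Q k i j) * w k := by
              cases k with
              | zero => simp [W.Q_zero]
              | succ k => rw [Nat.add_sub_cancel, hw k (by omega)]; ring
            have e3 := hh k i
            have e4 := W.rowSum_add k i
            rw [e2]
            have e5 : w (k + 1) = w k - h k := by linarith
            rw [e5]
            have : (∑ j, W.P k i j) * w k + (∑ j, W.Q k i j) * w k + (∑ j, W.R k i j) * w k = w k := by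
              rw [← add_mul, ← add_mul, e4, one_mul]
            nlinarith
    · simp [v, hk]
  refine hv.trans_lt ?_
  simp [v, hm]

/-! ### Positive recurrence of layer `0` spreads to all layers. -/

theorem mul_killedTime_le (W : HalfStripWalk d) {S : Set ℕ} (x : ℕ × Fin d) {y : ℕ × Fin d}
    (hy : y.1 ∈ S) : ENNReal.ofReal (W.trans x y) * W.killedTime S y ≤ W.killedTime S x := by
  rw [W.killedTime_eq S x]
  refine le_trans ?_ le_add_self
  unfold killedOp
  have hy' : y ∈ (Prod.fst ⁻¹' S : Set (ℕ × Fin d)) := hy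
  refine le_trans (le_of_eq ?_) (ENNReal.le_tsum y)
  rw [Set.indicator_of_mem hy']

theorem killedTime_lt_top_of_trans_pos (W : HalfStripWalk d) {S : Set ℕ} {x y : ℕ × Fin d}
    (hx : W.killedTime S x < ∞) (hy : y.1 ∈ S) (hxy : 0 < W.trans x y) :
    W.killedTime S y < ∞ := by
  have h := (W.mul_killedTime_le x hy).trans_lt hx
  exact ENNReal.lt_top_of_mul_ne_top_right h.ne (by simpa using hxy)

theorem ConditionC.exists_P_pos {W : HalfStripWalk d} (hC : W.ConditionC) (n : ℕ) (j : Fin d) :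
    ∃ i, 0 < W.P n i j := by
  obtain ⟨i, _, hi⟩ := Finset.exists_lt_of_sum_lt
    (s := Finset.univ) (f := fun _ : Fin d => (0 : ℝ)) (g := fun i => W.P n i j)
    (by simpa using hC.col_P n j)
  exact ⟨i, hi⟩

theorem layerPositiveRecurrent_iff (W : HalfStripWalk d) (n : ℕ) :
    W.LayerPositiveRecurrent n ↔ ∀ i, W.killedTime {n}ᶜ (n, i) < ∞ := by
  unfold LayerPositiveRecurrent
  simp only [meanReturnTime_eq]
  refine ⟨fun h i => ?_, fun h μ => ?_⟩
  · simpa [PMF.pure_apply] using h (PMF.pure i)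
  · exact ENNReal.sum_lt_top.2 fun i _ => ENNReal.mul_lt_top (μ.apply_lt_top i) (h i)

theorem killedTime_layer_zero (W : HalfStripWalk d) (i : Fin d) :
    W.killedTime {0}ᶜ (0, i) =
      1 + ∑ j, ENNReal.ofReal (W.P 0 i j) * W.killedTime {0}ᶜ (1, j) := by
  rw [killedTime_eq, killedOp_eq_sum]
  simp [W.Q_zero, W.R_zero, Set.indicator]

/-- Finiteness passes along transitions that survive, and the column condition on `P m` gives every
state of layer `m + 1` a predecessor in layer `m`. -/
theorem ConditionC.killedTime_lt_top {W : HalfStripWalk d} (hC : W.ConditionC)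
    (h : W.LayerPositiveRecurrent 0) (m : ℕ) (i : Fin d) : W.killedTime {0}ᶜ (m, i) < ∞ := by
  induction m generalizing i with
  | zero => exact (W.layerPositiveRecurrent_iff 0).1 h i
  | succ m ih =>
    obtain ⟨k, hk⟩ := hC.exists_P_pos m i
    exact W.killedTime_lt_top_of_trans_pos (ih k) (by simp) (by simpa [trans] using hk)

/-- From above `n` the walk must cross layer `n` to reach layer `0`; the lifetime for layer `0`, set
to `∞` at and below `n`, is a supersolution. -/
theorem killedTime_le_killedTime_zero (W : HalfStripWalk d) {m n : ℕ} (hm : n < m) (i : Fin d) :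
    W.killedTime {n}ᶜ (m, i) ≤ W.killedTime {0}ᶜ (m, i) := by
  let v : ℕ × Fin d → ℝ≥0∞ := fun x => if n < x.1 then W.killedTime {0}ᶜ x else ∞
  have hv : W.killedTime {n}ᶜ (m, i) ≤ v (m, i) := by
    refine W.killedTime_le (fun x _ => ?_) (by simpa using hm.ne')
    by_cases hx : n < x.1
    · simp only [v, if_pos hx]
      conv_rhs => rw [killedTime_eq]
      gcongr
      refine W.killedOp_le_of_near fun y _ hy => ?_
      rcases (show n ≤ y.1 by omega).lt_or_eq with h | h
      · simp [Set.indicator, h, h.ne', (Nat.zero_le n).trans_lt h |>.ne']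
      · simp [Set.indicator, h.symm]
    · simp [v, hx]
  simpa [v, hm] using hv

theorem ConditionC.positiveRecurrent_iff_layer_zero {W : HalfStripWalk d} (hC : W.ConditionC) :
    W.PositiveRecurrent ↔ W.LayerPositiveRecurrent 0 := by
  refine ⟨fun h => h 0, fun h n => ?_⟩
  rcases Nat.eq_zero_or_pos n with rfl | hn
  · exact h
  rw [layerPositiveRecurrent_iff]
  intro i
  rw [killedTime_eq, killedOp_eq_sum]
  refine ENNReal.add_lt_top.2 ⟨ENNReal.one_lt_top, ENNReal.sum_lt_top.2 fun j _ => ?_⟩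
  have hup : W.killedTime {n}ᶜ (n + 1, j) < ∞ :=
    (W.killedTime_le_killedTime_zero (Nat.lt_succ_self n) j).trans_lt (hC.killedTime_lt_top h _ _)
  have hdown : W.killedTime {n}ᶜ (n - 1, j) < ∞ := hC.killedTime_lt_top_of_lt (by omega) j
  have hn' : n - 1 ≠ n := by omega
  simpa [Set.indicator, hn'] using
    ⟨ENNReal.mul_lt_top ENNReal.ofReal_lt_top hup, ENNReal.mul_lt_top ENNReal.ofReal_lt_top hdown⟩

/-! ### The walk in a strip as a finite linear system. -/

/-- The real vectors of expected lifetimes, on the layers `0 < n < a`, of the walk killed on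
reaching layer `0` or layer `a`. -/
theorem ConditionC.exists_stripTime {W : HalfStripWalk d} (hC : W.ConditionC) (a : ℕ) :
    ∃ x : ℕ → Fin d → ℝ, x 0 = 0 ∧ x a = 0 ∧
      (∀ n, 1 ≤ n → n < a →
        x n = 1 + W.P n *ᵥ x (n + 1) + W.R n *ᵥ x n + W.Q n *ᵥ x (n - 1)) ∧
      ∀ n, 1 ≤ n → n < a → ∀ i,
        W.killedTime ({0}ᶜ ∩ Set.Iio a) (n, i) = ENNReal.ofReal (x n i) := by
  set S : Set ℕ := {0}ᶜ ∩ Set.Iio a with hS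
  let H : ℕ × Fin d → ℝ≥0∞ := (Prod.fst ⁻¹' S).indicator (W.killedTime S)
  have hSmem : ∀ n, n ∈ S ↔ 1 ≤ n ∧ n < a := fun n => by simp [hS, Nat.one_le_iff_ne_zero]
  -- The strip lies in the complement of layer `a`, so its lifetimes are at most the finite climbing
  -- times.
  have hfin : ∀ y, H y ≠ ∞ := by
    rintro ⟨n, i⟩
    by_cases hn : n ∈ S
    · simp only [H, Set.indicator, Set.mem_preimage, hn, if_true]
      refine ((W.killedTime_mono (S' := {a}ᶜ) (fun k hk => ?_) _).trans_lt
        (hC.killedTime_lt_top_of_lt ((hSmem n).1 hn).2 i)).ne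
      exact ((hSmem k).1 hk).2.ne
    · simp [H, hn]
  have hH : ∀ n ∈ S, ∀ i, H (n, i) = W.killedTime S (n, i) := fun n hn i => by
    simp [H, hn]
  refine ⟨fun n i => (H (n, i)).toReal, ?_, ?_, fun n h1 h2 => ?_, fun n h1 h2 i => ?_⟩
  · ext i; simp [H, hS]
  · ext i; simp [H, hS]
  · ext i
    change (H (n, i)).toReal = _
    rw [hH n ((hSmem n).2 ⟨h1, h2⟩), killedTime_eq, killedOp_eq_sum]
    change (1 + ∑ j, (ENNReal.ofReal (W.P n i j) * H (n + 1, j) +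
        ENNReal.ofReal (W.R n i j) * H (n, j) + ENNReal.ofReal (W.Q n i j) * H (n - 1, j))).toReal = _
    have hne : ∀ (r : ℝ) y, ENNReal.ofReal r * H y ≠ ∞ := fun r y =>
      ENNReal.mul_ne_top ENNReal.ofReal_ne_top (hfin y)
    rw [ENNReal.toReal_add ENNReal.one_ne_top (ENNReal.sum_ne_top.2 fun j _ =>
        ENNReal.add_ne_top.2 ⟨ENNReal.add_ne_top.2 ⟨hne _ _, hne _ _⟩, hne _ _⟩),
      ENNReal.toReal_sum fun j _ =>
        ENNReal.add_ne_top.2 ⟨ENNReal.add_ne_top.2 ⟨hne _ _, hne _ _⟩, hne _ _⟩]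
    simp only [Pi.add_apply, Pi.one_apply, Matrix.mulVec, dotProduct, ENNReal.toReal_one, add_assoc]
    congr 1
    rw [← Finset.sum_add_distrib, ← Finset.sum_add_distrib]
    refine Finset.sum_congr rfl fun j _ => ?_
    rw [ENNReal.toReal_add (hne _ _) (ENNReal.add_ne_top.2 ⟨hne _ _, hne _ _⟩),
      ENNReal.toReal_add (hne _ _) (hne _ _)]
    simp [ENNReal.toReal_mul, ENNReal.toReal_ofReal, W.P_nonneg, W.R_nonneg, W.Q_nonneg]
  · rw [ENNReal.ofReal_toReal (hfin _), hH n ((hSmem n).2 ⟨h1, h2⟩)]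

/-! ### Nonnegative matrices and the resolvent. -/

section Nonneg

variable {A B A' B' M : Matrix (Fin d) (Fin d) ℝ}

theorem mul_entry_nonneg (hA : ∀ i j, 0 ≤ A i j) (hB : ∀ i j, 0 ≤ B i j) (i j : Fin d) :
    0 ≤ (A * B) i j := by
  rw [Matrix.mul_apply]
  exact Finset.sum_nonneg fun k _ => mul_nonneg (hA i k) (hB k j)

theorem mul_entry_mono (hA : ∀ i j, 0 ≤ A i j) (hB : ∀ i j, 0 ≤ B i j)
    (hAA : ∀ i j, A i j ≤ A' i j) (hBB : ∀ i j, B i j ≤ B' i j) (i j : Fin d) :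
    (A * B) i j ≤ (A' * B') i j := by
  rw [Matrix.mul_apply, Matrix.mul_apply]
  exact Finset.sum_le_sum fun k _ =>
    mul_le_mul (hAA i k) (hBB k j) (hB k j) ((hA i k).trans (hAA i k))

theorem mulVec_nonneg_of_nonneg (hA : ∀ i j, 0 ≤ A i j) {v : Fin d → ℝ} (hv : 0 ≤ v) :
    0 ≤ A *ᵥ v := by
  intro i
  simp only [Matrix.mulVec, dotProduct]
  exact Finset.sum_nonneg fun k _ => mul_nonneg (hA i k) (hv k)

theorem mulVec_mono_of_nonneg (hA : ∀ i j, 0 ≤ A i j) (hAA : ∀ i j, A i j ≤ A' i j)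
    {v v' : Fin d → ℝ} (hv : 0 ≤ v) (hvv : v ≤ v') : A *ᵥ v ≤ A' *ᵥ v' := by
  intro i
  simp only [Matrix.mulVec, dotProduct]
  exact Finset.sum_le_sum fun k _ =>
    mul_le_mul (hAA i k) (hvv k) (hv k) ((hA i k).trans (hAA i k))

/-- Minimum principle: a negative minimum `x i` would give `((1 - M) *ᵥ x) i ≤ (1 - ∑ j, M i j) * x
i < 0`. Invertibility of `1 - M` and nonnegativity of its inverse follow. -/
theorem nonneg_of_one_sub_mulVec_nonneg (hM : ∀ i j, 0 ≤ M i j) (hM1 : ∀ i, ∑ j, M i j < 1)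
    {x : Fin d → ℝ} (hx : 0 ≤ (1 - M) *ᵥ x) : 0 ≤ x := by
  intro k
  obtain ⟨i, _, hi⟩ := Finset.exists_min_image Finset.univ x ⟨k, Finset.mem_univ k⟩
  refine le_trans ?_ (hi k (Finset.mem_univ k))
  have h1 : 0 ≤ x i - ∑ j, M i j * x j := by
    have := hx i
    rwa [Matrix.sub_mulVec, Matrix.one_mulVec] at this
  have h2 : (∑ j, M i j) * x i ≤ ∑ j, M i j * x j := by
    rw [Finset.sum_mul]
    exact Finset.sum_le_sum fun j _ => mul_le_mul_of_nonneg_left (hi j (Finset.mem_univ j)) (hM i j)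
  by_contra hneg
  push Not at hneg
  simp only [Pi.zero_apply] at hneg
  nlinarith [hM1 i]

theorem isUnit_det_one_sub (hM : ∀ i j, 0 ≤ M i j) (hM1 : ∀ i, ∑ j, M i j < 1) :
    IsUnit (1 - M).det := by
  rw [isUnit_iff_ne_zero]
  intro h
  obtain ⟨v, hv, hv0⟩ := Matrix.exists_mulVec_eq_zero_iff.2 h
  refine hv (le_antisymm ?_ (nonneg_of_one_sub_mulVec_nonneg hM hM1 hv0.ge))
  have := nonneg_of_one_sub_mulVec_nonneg hM hM1 (x := -v) (by rw [Matrix.mulVec_neg, hv0, neg_zero])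
  simpa using this

theorem inv_one_sub_nonneg (hM : ∀ i j, 0 ≤ M i j) (hM1 : ∀ i, ∑ j, M i j < 1) (i j : Fin d) :
    0 ≤ (1 - M)⁻¹ i j := by
  have h : (1 - M) *ᵥ ((1 - M)⁻¹ *ᵥ Pi.single j 1) = Pi.single j 1 := by
    rw [Matrix.mulVec_mulVec, Matrix.mul_nonsing_inv _ (isUnit_det_one_sub hM hM1),
      Matrix.one_mulVec]
  have := nonneg_of_one_sub_mulVec_nonneg hM hM1
    (h.symm ▸ Pi.single_nonneg.2 zero_le_one : 0 ≤ (1 - M) *ᵥ ((1 - M)⁻¹ *ᵥ Pi.single j 1)) i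
  simpa using this

theorem tendsto_mulVec {A : ℕ → Matrix (Fin d) (Fin d) ℝ} {v : ℕ → Fin d → ℝ} {v₀ : Fin d → ℝ}
    (hA : Tendsto A atTop (𝓝 M)) (hv : Tendsto v atTop (𝓝 v₀)) :
    Tendsto (fun a => A a *ᵥ v a) atTop (𝓝 (M *ᵥ v₀)) :=
  ((Continuous.matrix_mulVec continuous_fst continuous_snd).tendsto (M, v₀)).comp
    (hA.prodMk_nhds hv)

end Nonneg

/-- Nonnegative matrices with row sums at most `1`. -/
structure IsSubstochastic (Z : Matrix (Fin d) (Fin d) ℝ) : Prop where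
  nonneg : ∀ i j, 0 ≤ Z i j
  mulVec_one_le : Z *ᵥ 1 ≤ 1

theorem isSubstochastic_zero : IsSubstochastic (0 : Matrix (Fin d) (Fin d) ℝ) :=
  ⟨fun _ _ => le_rfl, by simp⟩

/-- The matrix `(I - P n Z - R n)⁻¹`. -/
def resolvent (W : HalfStripWalk d) (n : ℕ) (Z : Matrix (Fin d) (Fin d) ℝ) :
    Matrix (Fin d) (Fin d) ℝ :=
  (1 - W.P n * Z - W.R n)⁻¹

namespace ConditionC

variable {W : HalfStripWalk d} (hC : W.ConditionC) {n : ℕ} (hn : 1 ≤ n)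
  {Z Z' : Matrix (Fin d) (Fin d) ℝ}

theorem loop_nonneg (W : HalfStripWalk d) (hZ : IsSubstochastic Z) (i j : Fin d) :
    0 ≤ (W.P n * Z + W.R n) i j :=
  add_nonneg (mul_entry_nonneg (W.P_nonneg n) hZ.nonneg i j) (W.R_nonneg n i j)

theorem mulVec_one_apply (M : Matrix (Fin d) (Fin d) ℝ) (i : Fin d) : (M *ᵥ 1) i = ∑ j, M i j := by
  simp [Matrix.mulVec, dotProduct]

include hC hn

theorem loop_rowSum_lt (hZ : IsSubstochastic Z) (i : Fin d) :
    ∑ j, (W.P n * Z + W.R n) i j < 1 := by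
  have h1 : (W.P n *ᵥ (Z *ᵥ 1)) i ≤ (W.P n *ᵥ 1) i :=
    mulVec_mono_of_nonneg (W.P_nonneg n) (fun _ _ => le_rfl)
      (mulVec_nonneg_of_nonneg hZ.nonneg zero_le_one) hZ.mulVec_one_le i
  rw [Matrix.mulVec_mulVec, mulVec_one_apply, mulVec_one_apply] at h1
  simp only [Matrix.add_apply, Finset.sum_add_distrib]
  linarith [hC.rowSum_RP_lt hn i]

theorem isUnit_det_loop (hZ : IsSubstochastic Z) : IsUnit (1 - W.P n * Z - W.R n).det := by
  rw [sub_sub]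
  exact isUnit_det_one_sub (loop_nonneg W hZ) (hC.loop_rowSum_lt hn hZ)

theorem resolvent_nonneg (hZ : IsSubstochastic Z) (i j : Fin d) : 0 ≤ W.resolvent n Z i j := by
  unfold resolvent
  rw [sub_sub]
  exact inv_one_sub_nonneg (loop_nonneg W hZ) (hC.loop_rowSum_lt hn hZ) i j

theorem resolvent_mul (hZ : IsSubstochastic Z) :
    W.resolvent n Z * (1 - W.P n * Z - W.R n) = 1 :=
  Matrix.nonsing_inv_mul _ (hC.isUnit_det_loop hn hZ)

theorem mul_resolvent (hZ : IsSubstochastic Z) :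
    (1 - W.P n * Z - W.R n) * W.resolvent n Z = 1 :=
  Matrix.mul_nonsing_inv _ (hC.isUnit_det_loop hn hZ)

theorem one_le_resolvent (hZ : IsSubstochastic Z) (i j : Fin d) :
    (1 : Matrix (Fin d) (Fin d) ℝ) i j ≤ W.resolvent n Z i j := by
  have h : W.resolvent n Z = 1 + W.resolvent n Z * (W.P n * Z + W.R n) := by
    have := hC.resolvent_mul hn hZ
    rw [sub_sub, mul_sub, mul_one, sub_eq_iff_eq_add] at this
    exact this
  rw [h]
  exact le_add_of_nonneg_right
    (mul_entry_nonneg (hC.resolvent_nonneg hn hZ) (loop_nonneg W hZ) i j)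

theorem resolvent_sub (hZ : IsSubstochastic Z) (hZ' : IsSubstochastic Z') :
    W.resolvent n Z' - W.resolvent n Z =
      W.resolvent n Z * W.P n * (Z' - Z) * W.resolvent n Z' := by
  have h1 := hC.resolvent_mul hn hZ
  have h2 := hC.mul_resolvent hn hZ'
  have h3 : W.P n * (Z' - Z) = (1 - W.P n * Z - W.R n) - (1 - W.P n * Z' - W.R n) := by
    rw [mul_sub]; abel
  rw [Matrix.mul_assoc (W.resolvent n Z), h3, mul_sub, sub_mul, h1, one_mul, Matrix.mul_assoc, h2,
    mul_one]

theorem resolvent_mono (hZ : IsSubstochastic Z) (hZ' : IsSubstochastic Z')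
    (hle : ∀ i j, Z i j ≤ Z' i j) (i j : Fin d) : W.resolvent n Z i j ≤ W.resolvent n Z' i j := by
  rw [← sub_nonneg, ← Matrix.sub_apply, hC.resolvent_sub hn hZ hZ']
  exact mul_entry_nonneg (mul_entry_nonneg (mul_entry_nonneg (hC.resolvent_nonneg hn hZ)
    (W.P_nonneg n)) fun i j => sub_nonneg.2 (hle i j)) (hC.resolvent_nonneg hn hZ') i j

theorem tendsto_resolvent {Y : ℕ → Matrix (Fin d) (Fin d) ℝ} (hZ : IsSubstochastic Z)
    (hY : Tendsto Y atTop (𝓝 Z)) :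
    Tendsto (fun a => W.resolvent n (Y a)) atTop (𝓝 (W.resolvent n Z)) := by
  have hcont : ContinuousAt Inv.inv (1 - W.P n * Z - W.R n) := by
    refine continuousAt_matrix_inv _ ?_
    rw [Ring.inverse_eq_inv']
    exact continuousAt_inv₀ (hC.isUnit_det_loop hn hZ).ne_zero
  exact hcont.tendsto.comp (((tendsto_const_nhds).sub (tendsto_const_nhds.mul hY)).sub
    tendsto_const_nhds)

/-- The row sum condition reads `Q 𝟏 = (I - P Z - R) 𝟏 - P (𝟏 - Z 𝟏)`; apply the resolvent. A defect
in the row sums of `Z` is thus carried down one layer by `Aminus`. -/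
theorem one_sub_exit_mulVec (hZ : IsSubstochastic Z) :
    1 - (W.resolvent n Z * W.Q n) *ᵥ 1 = (W.resolvent n Z * W.P n) *ᵥ (1 - Z *ᵥ 1) := by
  have h1 : W.Q n *ᵥ 1 = (1 - W.P n * Z - W.R n) *ᵥ 1 - W.P n *ᵥ (1 - Z *ᵥ 1) := by
    have h := W.row_sum n
    simp only [Matrix.add_mulVec] at h
    simp only [Matrix.sub_mulVec, Matrix.mulVec_sub, Matrix.one_mulVec, Matrix.mulVec_mulVec]
    nth_rewrite 2 [← h]
    abel
  rw [← Matrix.mulVec_mulVec, h1, Matrix.mulVec_sub, Matrix.mulVec_mulVec, hC.resolvent_mul hn hZ,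
    Matrix.one_mulVec, Matrix.mulVec_mulVec]
  abel

theorem exit_isSubstochastic (hZ : IsSubstochastic Z) :
    IsSubstochastic (W.resolvent n Z * W.Q n) := by
  refine ⟨mul_entry_nonneg (hC.resolvent_nonneg hn hZ) (W.Q_nonneg n), ?_⟩
  rw [← sub_nonneg, hC.one_sub_exit_mulVec hn hZ]
  exact mulVec_nonneg_of_nonneg (mul_entry_nonneg (hC.resolvent_nonneg hn hZ) (W.P_nonneg n))
    (sub_nonneg.2 hZ.mulVec_one_le)

end ConditionC

/-! ### Exit matrices, their monotonicity and their limits. -/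

theorem exitFrom_succ (W : HalfStripWalk d) (ρ : Matrix (Fin d) (Fin d) ℝ) (k n : ℕ) :
    W.exitFrom ρ (k + 1) n = W.resolvent n (W.exitFrom ρ k (n + 1)) * W.Q n := rfl

theorem exitMatrix_eq (W : HalfStripWalk d) (ρ : Matrix (Fin d) (Fin d) ℝ) {n a : ℕ} (h : n < a) :
    W.exitMatrix ρ n a = W.resolvent n (W.exitMatrix ρ (n + 1) a) * W.Q n := by
  unfold exitMatrix
  obtain ⟨k, rfl⟩ := Nat.exists_eq_add_of_lt h
  rw [show n + k + 1 - n = k + 1 by omega, show n + k + 1 - (n + 1) = k by omega, exitFrom_succ]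

namespace ConditionC

variable {W : HalfStripWalk d} (hC : W.ConditionC) {ρ ρ' : Matrix (Fin d) (Fin d) ℝ}

include hC

theorem exitFrom_isSubstochastic (hρ : IsSubstochastic ρ) (k : ℕ) {n : ℕ} (hn : 1 ≤ n) :
    IsSubstochastic (W.exitFrom ρ k n) := by
  induction k generalizing n with
  | zero => exact hρ
  | succ k ih => exact hC.exit_isSubstochastic hn (ih (by omega))

theorem exit_mono {Z Z' : Matrix (Fin d) (Fin d) ℝ} {n : ℕ} (hn : 1 ≤ n) (hZ : IsSubstochastic Z)
    (hZ' : IsSubstochastic Z') (hle : ∀ i j, Z i j ≤ Z' i j) (i j : Fin d) :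
    (W.resolvent n Z * W.Q n) i j ≤ (W.resolvent n Z' * W.Q n) i j :=
  mul_entry_mono (hC.resolvent_nonneg hn hZ) (W.Q_nonneg n) (hC.resolvent_mono hn hZ hZ' hle)
    (fun _ _ => le_rfl) i j

theorem exitFrom_mono (hρ : IsSubstochastic ρ) (hρ' : IsSubstochastic ρ')
    (hle : ∀ i j, ρ i j ≤ ρ' i j) (k : ℕ) {n : ℕ} (hn : 1 ≤ n) (i j : Fin d) :
    W.exitFrom ρ k n i j ≤ W.exitFrom ρ' k n i j := by
  induction k generalizing n i j with
  | zero => exact hle i j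
  | succ k ih =>
    exact hC.exit_mono hn (hC.exitFrom_isSubstochastic hρ k (by omega))
      (hC.exitFrom_isSubstochastic hρ' k (by omega)) (ih (by omega)) i j

theorem exitFrom_zero_le_succ (k : ℕ) {n : ℕ} (hn : 1 ≤ n) (i j : Fin d) :
    W.exitFrom 0 k n i j ≤ W.exitFrom 0 (k + 1) n i j := by
  induction k generalizing n i j with
  | zero => exact (hC.exitFrom_isSubstochastic isSubstochastic_zero 1 hn).nonneg i j
  | succ k ih =>
    exact hC.exit_mono hn (hC.exitFrom_isSubstochastic isSubstochastic_zero k (by omega))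
      (hC.exitFrom_isSubstochastic isSubstochastic_zero (k + 1) (by omega)) (ih (by omega)) i j

end ConditionC

theorem IsSubstochastic.entry_le_one {Z : Matrix (Fin d) (Fin d) ℝ} (hZ : IsSubstochastic Z)
    (i j : Fin d) : Z i j ≤ 1 := by
  have h := hZ.mulVec_one_le i
  rw [ConditionC.mulVec_one_apply] at h
  exact (Finset.single_le_sum (fun j _ => hZ.nonneg i j) (Finset.mem_univ j)).trans h

/-- The law, possibly defective, of the first point visited in layer `n - 1` by the walk started
in layer `n`. -/
def minExit (W : HalfStripWalk d) (n : ℕ) : Matrix (Fin d) (Fin d) ℝ :=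
  fun i j => ⨆ k, W.exitFrom 0 k n i j

theorem ConditionC.tendsto_exitFrom_zero {W : HalfStripWalk d} (hC : W.ConditionC) {n : ℕ}
    (hn : 1 ≤ n) (i j : Fin d) :
    Tendsto (fun k => W.exitFrom 0 k n i j) atTop (𝓝 (W.minExit n i j)) :=
  tendsto_atTop_ciSup (monotone_nat_of_le_succ fun k => hC.exitFrom_zero_le_succ k hn i j)
    ⟨1, by
      rintro _ ⟨k, rfl⟩
      exact (hC.exitFrom_isSubstochastic isSubstochastic_zero k hn).entry_le_one i j⟩

theorem ConditionC.exitMatrix_zero_le_minExit {W : HalfStripWalk d} (hC : W.ConditionC) {n : ℕ}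
    (hn : 1 ≤ n) (a : ℕ) (i j : Fin d) : W.exitMatrix 0 n a i j ≤ W.minExit n i j :=
  (monotone_nat_of_le_succ fun k => hC.exitFrom_zero_le_succ k hn i j).ge_of_tendsto
    (hC.tendsto_exitFrom_zero hn i j) _

theorem ConditionC.isExitLimit_minExit {W : HalfStripWalk d} (hC : W.ConditionC) :
    W.IsExitLimit 0 W.minExit := fun n hn =>
  tendsto_pi_nhds.2 fun i => tendsto_pi_nhds.2 fun j =>
    (hC.tendsto_exitFrom_zero hn i j).comp (tendsto_sub_atTop_nat n)

theorem ConditionC.exitMatrix_isSubstochastic {W : HalfStripWalk d} (hC : W.ConditionC)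
    {ρ : Matrix (Fin d) (Fin d) ℝ} (hρ : IsSubstochastic ρ) {n : ℕ} (hn : 1 ≤ n) (a : ℕ) :
    IsSubstochastic (W.exitMatrix ρ n a) :=
  hC.exitFrom_isSubstochastic hρ _ hn

namespace IsExitLimit

variable {W : HalfStripWalk d} {ρ : Matrix (Fin d) (Fin d) ℝ}
  {ζ : ℕ → Matrix (Fin d) (Fin d) ℝ} (h : W.IsExitLimit ρ ζ)

include h

theorem tendsto_apply {n : ℕ} (hn : 1 ≤ n) (i j : Fin d) :
    Tendsto (fun a => W.exitMatrix ρ n a i j) atTop (𝓝 (ζ n i j)) :=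
  tendsto_pi_nhds.1 (tendsto_pi_nhds.1 (h n hn) i) j

theorem tendsto_rowSum {n : ℕ} (hn : 1 ≤ n) (i : Fin d) :
    Tendsto (fun a => (W.exitMatrix ρ n a *ᵥ 1) i) atTop (𝓝 ((ζ n *ᵥ 1) i)) := by
  simp only [ConditionC.mulVec_one_apply]
  exact tendsto_finsetSum _ fun j _ => h.tendsto_apply hn i j

theorem isSubstochastic (hC : W.ConditionC) (hρ : IsSubstochastic ρ) {n : ℕ} (hn : 1 ≤ n) :
    IsSubstochastic (ζ n) :=
  ⟨fun i j => ge_of_tendsto' (h.tendsto_apply hn i j) fun a =>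
      (hC.exitMatrix_isSubstochastic hρ hn a).nonneg i j,
    fun i => le_of_tendsto' (h.tendsto_rowSum hn i) fun a =>
      (hC.exitMatrix_isSubstochastic hρ hn a).mulVec_one_le i⟩

theorem minExit_le (hC : W.ConditionC) (hρ : IsSubstochastic ρ) {n : ℕ} (hn : 1 ≤ n)
    (i j : Fin d) : W.minExit n i j ≤ ζ n i j :=
  le_of_tendsto_of_tendsto' (hC.isExitLimit_minExit.tendsto_apply hn i j) (h.tendsto_apply hn i j)
    fun _ => hC.exitFrom_mono isSubstochastic_zero hρ hρ.nonneg _ hn i j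

theorem tendsto_resolvent (hC : W.ConditionC) (hρ : IsSubstochastic ρ) {n : ℕ} (hn : 1 ≤ n) :
    Tendsto (fun a => W.resolvent n (W.exitMatrix ρ (n + 1) a)) atTop
      (𝓝 (W.resolvent n (ζ (n + 1)))) :=
  hC.tendsto_resolvent hn (h.isSubstochastic hC hρ (by omega)) (h (n + 1) (by omega))

theorem eq_exit (hC : W.ConditionC) (hρ : IsSubstochastic ρ) {n : ℕ} (hn : 1 ≤ n) :
    ζ n = W.resolvent n (ζ (n + 1)) * W.Q n := by
  refine tendsto_nhds_unique (h n hn) ?_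
  refine ((h.tendsto_resolvent hC hρ hn).mul tendsto_const_nhds).congr' ?_
  filter_upwards [eventually_gt_atTop n] with a ha
  exact (W.exitMatrix_eq ρ ha).symm

end IsExitLimit

/-! ### Partial sums of the series and block elimination. -/

/-- The partial sum of order `m` of `∑_{k ≥ n} A n ⋯ A (k - 1) u k`, where
`A k = (I - P k Z_{k+1} - R k)⁻¹ P k` and `u k = (I - P k Z_{k+1} - R k)⁻¹ 𝟏`. -/
def partialVec (W : HalfStripWalk d) (Z : ℕ → Matrix (Fin d) (Fin d) ℝ) : ℕ → ℕ → Fin d → ℝ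
  | 0, _ => 0
  | m + 1, n => W.resolvent n (Z (n + 1)) *ᵥ (1 + W.P n *ᵥ W.partialVec Z m (n + 1))

theorem sum_prodAminus_add (W : HalfStripWalk d) (ζ : ℕ → Matrix (Fin d) (Fin d) ℝ) (m k : ℕ) :
    ∑ l ∈ Finset.range m, W.prodAminus ζ l *ᵥ W.uminus ζ (l + 1) +
      W.prodAminus ζ m *ᵥ W.partialVec ζ k (m + 1) = W.partialVec ζ (m + k) 1 := by
  induction m generalizing k with
  | zero => simp [prodAminus]
  | succ m ih =>
    rw [add_assoc m 1 k, add_comm 1 k, ← ih (k + 1), Finset.sum_range_succ, add_assoc]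
    congr 1
    rw [prodAminus, ← Matrix.mulVec_mulVec, ← Matrix.mulVec_add]
    congr 1
    rw [partialVec, Matrix.mulVec_add, Matrix.mulVec_mulVec]
    rfl

theorem partialVec_one (W : HalfStripWalk d) (ζ : ℕ → Matrix (Fin d) (Fin d) ℝ) (m : ℕ) :
    W.partialVec ζ m 1 = ∑ l ∈ Finset.range m, W.prodAminus ζ l *ᵥ W.uminus ζ (l + 1) := by
  have := W.sum_prodAminus_add ζ m 0
  rw [partialVec, Matrix.mulVec_zero, add_zero] at this
  exact this.symm

namespace ConditionC

variable {W : HalfStripWalk d} (hC : W.ConditionC) {Z Z' : ℕ → Matrix (Fin d) (Fin d) ℝ}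

include hC

theorem partialVec_nonneg (hZ : ∀ n, 1 ≤ n → IsSubstochastic (Z n)) (m : ℕ) {n : ℕ} (hn : 1 ≤ n) :
    0 ≤ W.partialVec Z m n := by
  induction m generalizing n with
  | zero => exact le_rfl
  | succ m ih =>
    exact mulVec_nonneg_of_nonneg (hC.resolvent_nonneg hn (hZ _ (by omega)))
      (add_nonneg zero_le_one (mulVec_nonneg_of_nonneg (W.P_nonneg n) (ih (by omega))))

theorem partialVec_mono (hZ : ∀ n, 1 ≤ n → IsSubstochastic (Z n))
    (hZ' : ∀ n, 1 ≤ n → IsSubstochastic (Z' n)) (hle : ∀ n, 1 ≤ n → ∀ i j, Z n i j ≤ Z' n i j)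
    (m : ℕ) {n : ℕ} (hn : 1 ≤ n) : W.partialVec Z m n ≤ W.partialVec Z' m n := by
  induction m generalizing n with
  | zero => exact le_rfl
  | succ m ih =>
    have h0 := hC.partialVec_nonneg hZ m (n := n + 1) (by omega)
    exact mulVec_mono_of_nonneg (hC.resolvent_nonneg hn (hZ _ (by omega)))
      (hC.resolvent_mono hn (hZ _ (by omega)) (hZ' _ (by omega)) (hle _ (by omega)))
      (add_nonneg zero_le_one (mulVec_nonneg_of_nonneg (W.P_nonneg n) h0))
      (add_le_add le_rfl (mulVec_mono_of_nonneg (W.P_nonneg n) (fun _ _ => le_rfl) h0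
        (ih (by omega))))

theorem partialVec_le_succ (hZ : ∀ n, 1 ≤ n → IsSubstochastic (Z n)) (m : ℕ) {n : ℕ}
    (hn : 1 ≤ n) : W.partialVec Z m n ≤ W.partialVec Z (m + 1) n := by
  induction m generalizing n with
  | zero => exact hC.partialVec_nonneg hZ 1 hn
  | succ m ih =>
    have h0 := hC.partialVec_nonneg hZ m (n := n + 1) (by omega)
    exact mulVec_mono_of_nonneg (hC.resolvent_nonneg hn (hZ _ (by omega))) (fun _ _ => le_rfl)
      (add_nonneg zero_le_one (mulVec_nonneg_of_nonneg (W.P_nonneg n) h0))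
      (add_le_add le_rfl (mulVec_mono_of_nonneg (W.P_nonneg n) (fun _ _ => le_rfl) h0
        (ih (by omega))))

theorem tendsto_partialVec (m : ℕ) {n : ℕ} (hn : 1 ≤ n) :
    Tendsto (fun a => W.partialVec (fun n => W.exitMatrix 0 n a) m n) atTop
      (𝓝 (W.partialVec W.minExit m n)) := by
  induction m generalizing n with
  | zero => exact tendsto_const_nhds
  | succ m ih =>
    exact tendsto_mulVec (hC.isExitLimit_minExit.tendsto_resolvent hC isSubstochastic_zero hn)
      (tendsto_const_nhds.add (tendsto_mulVec tendsto_const_nhds (ih (by omega))))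

/-- Backward block elimination. At `n = a` both sides vanish because the terminal matrix is `0`;
below, substituting the formula for `x (n + 1)` into the equation at `n` leaves `(I - P Z - R) x n`
on the left. -/
theorem stripTime_eq {a : ℕ} {x : ℕ → Fin d → ℝ} (hxa : x a = 0)
    (hx : ∀ n, 1 ≤ n → n < a →
      x n = 1 + W.P n *ᵥ x (n + 1) + W.R n *ᵥ x n + W.Q n *ᵥ x (n - 1))
    (k : ℕ) {n : ℕ} (hn : 1 ≤ n) (hk : n + k = a) :
    x n = W.exitMatrix 0 n a *ᵥ x (n - 1) +
      W.partialVec (fun n => W.exitMatrix 0 n a) k n := by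
  induction k generalizing n with
  | zero =>
    obtain rfl : n = a := by omega
    simp [exitMatrix, exitFrom, partialVec, hxa]
  | succ k ih =>
    have hnext := ih (n := n + 1) (by omega) (by omega)
    rw [Nat.add_sub_cancel] at hnext
    have hZ := hC.exitMatrix_isSubstochastic isSubstochastic_zero (n := n + 1) (by omega) a
    have h1 : (1 - W.P n * W.exitMatrix 0 (n + 1) a - W.R n) *ᵥ x n =
        W.Q n *ᵥ x (n - 1) +
          (1 + W.P n *ᵥ W.partialVec (fun n => W.exitMatrix 0 n a) k (n + 1)) := by
      have h := hx n hn (by omega)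
      rw [hnext, Matrix.mulVec_add, Matrix.mulVec_mulVec] at h
      rw [Matrix.sub_mulVec, Matrix.sub_mulVec, Matrix.one_mulVec]
      nth_rewrite 1 [h]
      abel
    have h2 := congrArg (fun v => W.resolvent n (W.exitMatrix 0 (n + 1) a) *ᵥ v) h1
    rw [Matrix.mulVec_mulVec, hC.resolvent_mul hn hZ, Matrix.one_mulVec, Matrix.mulVec_add,
      Matrix.mulVec_mulVec, ← W.exitMatrix_eq 0 (by omega)] at h2
    exact h2

theorem killedTime_strip {a : ℕ} (ha : 1 < a) (i : Fin d) :
    W.killedTime ({0}ᶜ ∩ Set.Iio a) (1, i) =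
      ENNReal.ofReal (W.partialVec (fun n => W.exitMatrix 0 n a) (a - 1) 1 i) := by
  obtain ⟨x, hx0, hxa, hx, hxH⟩ := hC.exists_stripTime a
  have := hC.stripTime_eq hxa hx (a - 1) le_rfl (by omega)
  rw [Nat.sub_self, hx0, Matrix.mulVec_zero, zero_add] at this
  rw [hxH 1 le_rfl ha, this]

theorem minExit_isSubstochastic {n : ℕ} (hn : 1 ≤ n) : IsSubstochastic (W.minExit n) :=
  hC.isExitLimit_minExit.isSubstochastic hC isSubstochastic_zero hn

end ConditionC

/-! ### The series formula and the escape probabilities. -/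

theorem one_entry_nonneg (i j : Fin d) : 0 ≤ (1 : Matrix (Fin d) (Fin d) ℝ) i j := by
  rw [Matrix.one_apply]
  split_ifs <;> norm_num

theorem mul_eq_zero_of_mulVec_eq_zero {A : Matrix (Fin d) (Fin d) ℝ} {v : Fin d → ℝ} {k : Fin d}
    (hA : ∀ i j, 0 ≤ A i j) (hv : 0 ≤ v) (h : (A *ᵥ v) k = 0) (i : Fin d) : A k i * v i = 0 := by
  simp only [Matrix.mulVec, dotProduct] at h
  exact (Finset.sum_eq_zero_iff_of_nonneg fun i _ => mul_nonneg (hA k i) (hv i)).1 h i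
    (Finset.mem_univ i)

theorem mulVec_apply_congr {A B : Matrix (Fin d) (Fin d) ℝ} {k : Fin d} (h : A k = B k)
    (v : Fin d → ℝ) : (A *ᵥ v) k = (B *ᵥ v) k := by
  simp only [Matrix.mulVec, dotProduct, h]

namespace ConditionC

variable {W : HalfStripWalk d} (hC : W.ConditionC) {Z Z' : ℕ → Matrix (Fin d) (Fin d) ℝ}

include hC

theorem aminus_nonneg (hZ : ∀ n, 1 ≤ n → IsSubstochastic (Z n)) {n : ℕ} (hn : 1 ≤ n)
    (i j : Fin d) : 0 ≤ W.Aminus Z n i j :=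
  mul_entry_nonneg (hC.resolvent_nonneg hn (hZ _ (by omega))) (W.P_nonneg n) i j

theorem prodAminus_nonneg (hZ : ∀ n, 1 ≤ n → IsSubstochastic (Z n)) (m : ℕ) (i j : Fin d) :
    0 ≤ W.prodAminus Z m i j := by
  induction m generalizing i j with
  | zero => exact one_entry_nonneg i j
  | succ m ih => exact mul_entry_nonneg ih (hC.aminus_nonneg hZ (by omega)) i j

theorem one_le_uminus (hZ : ∀ n, 1 ≤ n → IsSubstochastic (Z n)) {n : ℕ} (hn : 1 ≤ n) :
    1 ≤ W.uminus Z n := by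
  have h := mulVec_mono_of_nonneg (A := 1) (v := 1)
    one_entry_nonneg
    (hC.one_le_resolvent hn (hZ (n + 1) (by omega))) zero_le_one le_rfl
  rw [Matrix.one_mulVec] at h
  exact h

theorem seriesTerm_nonneg (hZ : ∀ n, 1 ≤ n → IsSubstochastic (Z n)) (m : ℕ) :
    0 ≤ W.prodAminus Z m *ᵥ W.uminus Z (m + 1) :=
  mulVec_nonneg_of_nonneg (hC.prodAminus_nonneg hZ m)
    (zero_le_one.trans (hC.one_le_uminus hZ (by omega)))

theorem ofReal_partialVec_one (hZ : ∀ n, 1 ≤ n → IsSubstochastic (Z n)) (m : ℕ) (j : Fin d) :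
    ENNReal.ofReal (W.partialVec Z m 1 j) = ∑ l ∈ Finset.range m,
      ENNReal.ofReal ((W.prodAminus Z l *ᵥ W.uminus Z (l + 1)) j) := by
  rw [partialVec_one, Finset.sum_apply,
    ENNReal.ofReal_sum_of_nonneg fun l _ => hC.seriesTerm_nonneg hZ l j]

theorem killedTime_layer_one (j : Fin d) :
    W.killedTime {0}ᶜ (1, j) = W.seriesVec W.minExit j := by
  have hF : ∀ n, 1 ≤ n → IsSubstochastic (W.minExit n) := fun n hn => hC.minExit_isSubstochastic hn
  have hZ : ∀ a n, 1 ≤ n → IsSubstochastic (W.exitMatrix 0 n a) := fun a n hn =>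
    hC.exitMatrix_isSubstochastic isSubstochastic_zero hn a
  refine le_antisymm ?_ ?_
  · refine W.killedTime_le_of_forall_inter_Iio fun a ha => ?_
    rw [hC.killedTime_strip ha]
    refine (ENNReal.ofReal_le_ofReal (hC.partialVec_mono (hZ a) hF
      (fun n hn => hC.exitMatrix_zero_le_minExit hn a) _ le_rfl j)).trans ?_
    rw [hC.ofReal_partialVec_one hF]
    exact ENNReal.sum_le_tsum _
  · refine ENNReal.tsum_le_of_sum_range_le fun m => ?_
    rw [← hC.ofReal_partialVec_one hF]
    refine le_of_tendsto (ENNReal.tendsto_ofReal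
      (tendsto_pi_nhds.1 (hC.tendsto_partialVec m le_rfl) j)) ?_
    -- For such `a` the order `m` is at most `a - 1`, the order at which the partial sum is the
    -- exact strip lifetime.
    filter_upwards [eventually_gt_atTop (m + 1)] with a ha
    refine le_trans (ENNReal.ofReal_le_ofReal ?_)
      ((hC.killedTime_strip (a := a) (by omega) j).symm.trans_le
        (W.killedTime_mono Set.inter_subset_left _))
    exact monotone_nat_of_le_succ
      (fun k => hC.partialVec_le_succ (hZ a) k le_rfl j) (show m ≤ a - 1 by omega)

theorem seriesVec_mono (hZ : ∀ n, 1 ≤ n → IsSubstochastic (Z n))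
    (hZ' : ∀ n, 1 ≤ n → IsSubstochastic (Z' n)) (hle : ∀ n, 1 ≤ n → ∀ i j, Z n i j ≤ Z' n i j)
    (j : Fin d) : W.seriesVec Z j ≤ W.seriesVec Z' j := by
  refine ENNReal.tsum_le_of_sum_range_le fun m => ?_
  rw [← hC.ofReal_partialVec_one hZ]
  refine (ENNReal.ofReal_le_ofReal (hC.partialVec_mono hZ hZ' hle m le_rfl j)).trans ?_
  rw [hC.ofReal_partialVec_one hZ']
  exact ENNReal.sum_le_tsum _

/-- The escape probabilities `1 - minExit n 𝟏` are harmonic. -/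
theorem escape_eq {n : ℕ} (hn : 1 ≤ n) :
    1 - W.minExit n *ᵥ 1 = W.Aminus W.minExit n *ᵥ (1 - W.minExit (n + 1) *ᵥ 1) := by
  nth_rewrite 1 [hC.isExitLimit_minExit.eq_exit hC isSubstochastic_zero hn]
  exact hC.one_sub_exit_mulVec hn (hC.minExit_isSubstochastic (by omega))

theorem escape_nonneg {n : ℕ} (hn : 1 ≤ n) : 0 ≤ 1 - W.minExit n *ᵥ 1 :=
  sub_nonneg.2 (hC.minExit_isSubstochastic hn).mulVec_one_le

theorem escape_le_one {n : ℕ} (hn : 1 ≤ n) : 1 - W.minExit n *ᵥ 1 ≤ 1 :=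
  sub_le_self _ (mulVec_nonneg_of_nonneg (hC.minExit_isSubstochastic hn).nonneg zero_le_one)

theorem escape_one_eq (m : ℕ) :
    1 - W.minExit 1 *ᵥ 1 = W.prodAminus W.minExit m *ᵥ (1 - W.minExit (m + 1) *ᵥ 1) := by
  induction m with
  | zero => simp [prodAminus]
  | succ m ih => rw [ih, hC.escape_eq (by omega), Matrix.mulVec_mulVec]; rfl

/-- Since `uminus ≥ 1` dominates the escape vector, every term of the series is at least
`prodAminus` applied to that vector, which is the escape vector of layer `1` whatever `m` is. The
terms of a convergent series tend to `0`. -/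
theorem escape_one_eq_zero {k : Fin d} (hk : W.seriesVec W.minExit k ≠ ∞) :
    (1 - W.minExit 1 *ᵥ 1) k = 0 := by
  have hF : ∀ n, 1 ≤ n → IsSubstochastic (W.minExit n) := fun n hn => hC.minExit_isSubstochastic hn
  have hlim := ENNReal.tendsto_atTop_zero_of_tsum_ne_top hk
  have hle : ENNReal.ofReal ((1 - W.minExit 1 *ᵥ 1) k) ≤ 0 := by
    refine ge_of_tendsto' hlim fun m => ENNReal.ofReal_le_ofReal ?_
    rw [hC.escape_one_eq m]
    exact mulVec_mono_of_nonneg (hC.prodAminus_nonneg hF m) (fun _ _ => le_rfl)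
      (hC.escape_nonneg (by omega))
      ((hC.escape_le_one (by omega)).trans (hC.one_le_uminus hF (by omega))) k
  exact le_antisymm (by simpa using hle) (hC.escape_nonneg le_rfl k)

end ConditionC

/-! ### The series does not depend on the terminal matrix. -/

namespace IsExitLimit

variable {W : HalfStripWalk d} {ρ : Matrix (Fin d) (Fin d) ℝ}
  {ζ : ℕ → Matrix (Fin d) (Fin d) ℝ}

/-- Row `k` of the product charges only states `i` with zero escape probability. There row `i` of
`minExit` already sums to `1`, so the larger substochastic `ζ` has the same row. -/
theorem prodAminus_mul_sub_eq_zero (hC : W.ConditionC) (hρ : IsSubstochastic ρ)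
    (h : W.IsExitLimit ρ ζ) {k : Fin d} (hk : W.seriesVec W.minExit k ≠ ∞) (m : ℕ) :
    (W.prodAminus W.minExit m * (ζ (m + 1) - W.minExit (m + 1))) k = 0 := by
  have hF : ∀ n, 1 ≤ n → IsSubstochastic (W.minExit n) := fun n hn => hC.minExit_isSubstochastic hn
  have h0 := hC.escape_one_eq_zero hk
  rw [hC.escape_one_eq m] at h0
  have hterm : ∀ i, W.prodAminus W.minExit m k i * (1 - W.minExit (m + 1) *ᵥ 1) i = 0 :=
    mul_eq_zero_of_mulVec_eq_zero (hC.prodAminus_nonneg hF m) (hC.escape_nonneg (by omega)) h0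
  ext j
  rw [Matrix.mul_apply]
  refine Finset.sum_eq_zero fun i _ => ?_
  rcases mul_eq_zero.1 (hterm i) with h1 | h1
  · rw [h1, zero_mul]
  · have hD : ∀ j, 0 ≤ (ζ (m + 1) - W.minExit (m + 1)) i j := fun j =>
      sub_nonneg.2 (h.minExit_le hC hρ (by omega) i j)
    have hsum : ∑ j, (ζ (m + 1) - W.minExit (m + 1)) i j ≤ 0 := by
      rw [← h1, ← ConditionC.mulVec_one_apply, Matrix.sub_mulVec]
      exact sub_le_sub_right ((h.isSubstochastic hC hρ (by omega)).mulVec_one_le i) _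
    rw [(Finset.sum_eq_zero_iff_of_nonneg fun j _ => hD j).1
      (le_antisymm hsum (Finset.sum_nonneg fun j _ => hD j)) j (Finset.mem_univ j), mul_zero]

/-- By `resolvent_sub` the difference factors through `prodAminus W.minExit (m + 1) * (ζ (m + 2) -
W.minExit (m + 2))`, whose row `k` vanishes. -/
theorem prodAminus_mul_resolvent_eq (hC : W.ConditionC) (hρ : IsSubstochastic ρ)
    (h : W.IsExitLimit ρ ζ) {k : Fin d} (hk : W.seriesVec W.minExit k ≠ ∞) (m : ℕ) :
    (W.prodAminus W.minExit m * W.resolvent (m + 1) (ζ (m + 2))) k =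
      (W.prodAminus W.minExit m * W.resolvent (m + 1) (W.minExit (m + 2))) k := by
  have h1 := hC.resolvent_sub (n := m + 1) (by omega)
    (hC.minExit_isSubstochastic (n := m + 2) (by omega))
    (h.isSubstochastic hC hρ (n := m + 2) (by omega))
  have h2 : W.prodAminus W.minExit m * W.resolvent (m + 1) (ζ (m + 2)) -
      W.prodAminus W.minExit m * W.resolvent (m + 1) (W.minExit (m + 2)) =
      W.prodAminus W.minExit (m + 1) * (ζ (m + 2) - W.minExit (m + 2)) *
        W.resolvent (m + 1) (ζ (m + 2)) := by
    rw [← mul_sub, h1, prodAminus, Aminus, ← resolvent]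
    simp only [Matrix.mul_assoc]
  rw [← sub_eq_zero]
  change (W.prodAminus W.minExit m * W.resolvent (m + 1) (ζ (m + 2)) -
      W.prodAminus W.minExit m * W.resolvent (m + 1) (W.minExit (m + 2))) k = 0
  rw [h2, Matrix.mul_apply_eq_vecMul, h.prodAminus_mul_sub_eq_zero hC hρ hk (m + 1),
    Matrix.zero_vecMul]

theorem prodAminus_row_eq (hC : W.ConditionC) (hρ : IsSubstochastic ρ)
    (h : W.IsExitLimit ρ ζ) {k : Fin d} (hk : W.seriesVec W.minExit k ≠ ∞) (m : ℕ) :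
    W.prodAminus ζ m k = W.prodAminus W.minExit m k := by
  induction m with
  | zero => rfl
  | succ m ih =>
    have h1 := h.prodAminus_mul_resolvent_eq hC hρ hk m
    rw [prodAminus, prodAminus, Matrix.mul_apply_eq_vecMul, ih, ← Matrix.mul_apply_eq_vecMul]
    change (W.prodAminus W.minExit m * (W.resolvent (m + 1) (ζ (m + 2)) * W.P (m + 1))) k =
      (W.prodAminus W.minExit m * (W.resolvent (m + 1) (W.minExit (m + 2)) * W.P (m + 1))) k
    rw [← Matrix.mul_assoc, ← Matrix.mul_assoc, Matrix.mul_apply_eq_vecMul, h1,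
      ← Matrix.mul_apply_eq_vecMul]

theorem seriesVec_eq (hC : W.ConditionC) (hρ : IsSubstochastic ρ) (h : W.IsExitLimit ρ ζ)
    (k : Fin d) : W.seriesVec ζ k = W.seriesVec W.minExit k := by
  have hmono := hC.seriesVec_mono (fun n hn => hC.minExit_isSubstochastic hn)
    (fun n hn => h.isSubstochastic hC hρ hn) (fun n hn => h.minExit_le hC hρ hn) k
  by_cases hk : W.seriesVec W.minExit k = ∞
  · rw [hk] at hmono ⊢
    exact top_le_iff.1 hmono
  · refine tsum_congr fun m => ?_
    congr 1
    change (W.prodAminus ζ m *ᵥ (W.resolvent (m + 1) (ζ (m + 2)) *ᵥ 1)) k =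
      (W.prodAminus W.minExit m *ᵥ (W.resolvent (m + 1) (W.minExit (m + 2)) *ᵥ 1)) k
    rw [Matrix.mulVec_mulVec, Matrix.mulVec_mulVec]
    refine mulVec_apply_congr ?_ 1
    rw [← h.prodAminus_mul_resolvent_eq hC hρ hk m, Matrix.mul_apply_eq_vecMul,
      h.prodAminus_row_eq hC hρ hk m, ← Matrix.mul_apply_eq_vecMul]

theorem killedTime_layer_zero_eq (hC : W.ConditionC) (hρ : IsSubstochastic ρ)
    (h : W.IsExitLimit ρ ζ) (i : Fin d) :
    W.killedTime {0}ᶜ (0, i) = 1 + ∑ j, ENNReal.ofReal (W.P 0 i j) * W.seriesVec ζ j := by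
  simp only [killedTime_layer_zero, hC.killedTime_layer_one, h.seriesVec_eq hC hρ]

theorem meanReturnTime_zero_eq (hC : W.ConditionC) (hρ : IsSubstochastic ρ)
    (h : W.IsExitLimit ρ ζ) (μ : PMF (Fin d)) : W.meanReturnTime 0 μ = W.varrho ζ μ := by
  simp only [meanReturnTime_eq, h.killedTime_layer_zero_eq hC hρ, varrho, mul_add, mul_one,
    Finset.mul_sum, Finset.sum_add_distrib, mul_assoc]
  rw [add_comm]

theorem layerPositiveRecurrent_zero_iff (hC : W.ConditionC) (hρ : IsSubstochastic ρ)
    (h : W.IsExitLimit ρ ζ) : W.LayerPositiveRecurrent 0 ↔ W.varrhoOne ζ < ∞ := by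
  rw [layerPositiveRecurrent_iff]
  simp only [h.killedTime_layer_zero_eq hC hρ, varrhoOne, ENNReal.add_lt_top, ENNReal.one_lt_top,
    true_and, ENNReal.natCast_lt_top, and_true]
  rw [ENNReal.sum_lt_top]
  simp

end IsExitLimit

/-! ### Existence of the limits under positive recurrence. -/

namespace ConditionC

variable {W : HalfStripWalk d} (hC : W.ConditionC)

include hC

/-- The vanishing climbs from layer `n` to `n + 1`: in `escape_eq` all terms are nonnegative,
`Aminus` dominates `P n`, and every column of `P n` has a positive entry. -/
theorem escape_eq_zero (h : W.LayerPositiveRecurrent 0) {n : ℕ} (hn : 1 ≤ n) :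
    1 - W.minExit n *ᵥ 1 = 0 := by
  have hF : ∀ n, 1 ≤ n → IsSubstochastic (W.minExit n) := fun n hn => hC.minExit_isSubstochastic hn
  induction n, hn using Nat.le_induction with
  | base =>
    ext k
    refine hC.escape_one_eq_zero ?_
    rw [← hC.killedTime_layer_one]
    exact (hC.killedTime_lt_top h 1 k).ne
  | succ n hn ih =>
    ext i
    obtain ⟨k, hk⟩ := hC.exists_P_pos n i
    have h0 : (W.Aminus W.minExit n *ᵥ (1 - W.minExit (n + 1) *ᵥ 1)) k = 0 := by
      rw [← hC.escape_eq hn, ih]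
      rfl
    have hterm := mul_eq_zero_of_mulVec_eq_zero (hC.aminus_nonneg hF hn)
      (hC.escape_nonneg (by omega)) h0 i
    have hA : W.P n k i ≤ W.Aminus W.minExit n k i := by
      have := mul_entry_mono (A := 1) (B := W.P n)
        one_entry_nonneg
        (W.P_nonneg n) (hC.one_le_resolvent hn (hF (n + 1) (by omega))) (fun _ _ => le_rfl) k i
      rwa [one_mul] at this
    exact (mul_eq_zero.1 hterm).resolve_left (hk.trans_le hA).ne'

/-- Squeeze: the exit matrix for `ρ` exceeds the one for `0` entrywise, by no more than the row
defect of the latter, which tends to the escape probability, namely `0`. -/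
theorem isExitLimit_of_layerPositiveRecurrent (h : W.LayerPositiveRecurrent 0)
    {ρ : Matrix (Fin d) (Fin d) ℝ} (hρ : IsSubstochastic ρ) : W.IsExitLimit ρ W.minExit := by
  intro n hn
  refine tendsto_pi_nhds.2 fun i => tendsto_pi_nhds.2 fun j => ?_
  have hlim := hC.isExitLimit_minExit
  have hupper : Tendsto (fun a => W.exitMatrix 0 n a i j + (1 - (W.exitMatrix 0 n a *ᵥ 1) i))
      atTop (𝓝 (W.minExit n i j)) := by
    have h0 : 1 - (W.minExit n *ᵥ 1) i = 0 := congrFun (hC.escape_eq_zero h hn) i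
    have := (hlim.tendsto_apply hn i j).add ((hlim.tendsto_rowSum hn i).const_sub 1)
    rwa [h0, add_zero] at this
  have hle : ∀ a j, W.exitMatrix 0 n a i j ≤ W.exitMatrix ρ n a i j := fun a j =>
    hC.exitFrom_mono isSubstochastic_zero hρ hρ.nonneg _ hn i j
  refine tendsto_of_tendsto_of_tendsto_of_le_of_le (hlim.tendsto_apply hn i j) hupper
    (fun a => hle a j) fun a => ?_
  have h1 := (hC.exitMatrix_isSubstochastic hρ hn a).mulVec_one_le i
  have h2 : W.exitMatrix ρ n a i j - W.exitMatrix 0 n a i j ≤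
      ∑ j, (W.exitMatrix ρ n a i j - W.exitMatrix 0 n a i j) :=
    Finset.single_le_sum (f := fun j => W.exitMatrix ρ n a i j - W.exitMatrix 0 n a i j)
      (fun j _ => sub_nonneg.2 (hle a j)) (Finset.mem_univ j)
  rw [Finset.sum_sub_distrib, ← mulVec_one_apply, ← mulVec_one_apply] at h2
  simp only [Pi.one_apply] at h1
  linarith

theorem layerPositiveRecurrent_zero_iff_exists {ρ : Matrix (Fin d) (Fin d) ℝ}
    (hρ : IsSubstochastic ρ) : W.LayerPositiveRecurrent 0 ↔
      ∃ ζ : ℕ → Matrix (Fin d) (Fin d) ℝ, W.IsExitLimit ρ ζ ∧ W.varrhoOne ζ < ∞ := by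
  refine ⟨fun h => ?_, fun ⟨ζ, hζ, hlt⟩ => (hζ.layerPositiveRecurrent_zero_iff hC hρ).2 hlt⟩
  have hlim := hC.isExitLimit_of_layerPositiveRecurrent h hρ
  exact ⟨W.minExit, hlim, (hlim.layerPositiveRecurrent_zero_iff hC hρ).1 h⟩

end ConditionC

end HalfStripWalk

end

theorem theorem2 (d : ℕ) (hd : 1 ≤ d) (W : HalfStripWalk d) (hC : W.ConditionC)
    (ρ : Matrix (Fin d) (Fin d) ℝ) (hρ : ρ ∈ Matrix.rowStochastic ℝ (Fin d)) :
    (W.PositiveRecurrent ↔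
      ∃ ζ : ℕ → Matrix (Fin d) (Fin d) ℝ, W.IsExitLimit ρ ζ ∧ W.varrhoOne ζ < ∞) ∧
    (W.LayerPositiveRecurrent 0 ↔
      ∃ ζ : ℕ → Matrix (Fin d) (Fin d) ℝ, W.IsExitLimit ρ ζ ∧ W.varrhoOne ζ < ∞) ∧
    (∀ ζ : ℕ → Matrix (Fin d) (Fin d) ℝ, W.IsExitLimit ρ ζ →
      ∀ μ : PMF (Fin d), W.meanReturnTime 0 μ = W.varrho ζ μ) := by
  have hsub : HalfStripWalk.IsSubstochastic ρ := ⟨hρ.1, hρ.2.le⟩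
  have h0 := hC.layerPositiveRecurrent_zero_iff_exists hsub
  exact ⟨hC.positiveRecurrent_iff_layer_zero.trans h0, h0,
    fun ζ hζ μ => hζ.meanReturnTime_zero_eq hC hsub μ⟩
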